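/- A \emph{bipartite graph} here is a finite graph in which parallel edges are allowed (a multigraph; in particular it may be a simple graph), whose vertices can be colored with two colors so that every edge joins two vertices of different colors. It is \emph{$d$-regular} if every vertex is incident with exactly $d$ edges. A \emph{$k$-matching} is a set of $k$ edges no two of which share an endpoint (parallel edges count as different edges), and $m_k(G)$ is the number of $k$-matchings of $G$. For a positive integer $d$ and $0\le p\le 1$ let $$\mathbb{G}_d(p)=\frac12\left(p\ln\frac dp+(d-p)\ln\left(1-\frac pd\right)-2(1-p)\ln(1-p)\right),$$ with the conventions $0\ln 0=0$ and $0\ln\frac d0=0$. Let $d,n\ge 1$ be integers. For an integer $0\le k\le n$ put $p=\frac kn$ and $p_\mu=\binom nk p^k(1-p)^{n-k}$ (with $0^0=1$), the probability that a Binomial$(n,p)$ random variable takes its mean value $k$. \textbf{(1)} For every $d$-regular bipartite graph $G$ on $2n$ vertices and every $0\le k\le n$, $$m_k(G)\ \ge\ p_\mu\,\exp\bigl(2n\,\mathbb{G}_d(p)\bigr).$$ \textbf{(2)} In particular, Friedland's Lower Matching Conjecture holds: for every such $G$ and $k$ (again with $0^0=1$), $$m_k(G)\ \ge\ \binom nk^2\left(\frac{d-p}{d}\right)^{n(d-p)}(dp)^{np}.$$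 \textbf{(3)} Conversely, for every $0\le k<n$ there exists a $d$-regular bipartite graph $G$ on $2n$ vertices such that $$m_k(G)\ \le\ \sqrt{\frac{1-p/d}{1-p}}\;p_\mu\,\exp\bigl(2n\,\mathbb{G}_d(p)\bigr).$$ -/

import Mathlib

namespace Graph

/-- The degree of a vertex of a multigraph: the number of edges incident to it, where a loop
counts twice. -/
noncomputable def degree {α β : Type*} (G : Graph α β) (x : α) : ℕ∞ :=
  (G.incidenceSet x).encard + (G.loopSet x).encard

/-- Every vertex has degree exactly `d`. -/
def IsRegular {α β : Type*} (G : Graph α β) (d : ℕ) : Prop :=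
  ∀ x ∈ G.vertexSet, G.degree x = d

/-- The vertices can be colored with two colors such that every edge connects two vertices of
different colors. -/
def IsBipartite {α β : Type*} (G : Graph α β) : Prop :=
  ∃ c : α → Bool, ∀ e x y, G.IsLink e x y → c x ≠ c y

/-- A `k`-matching of a loopless multigraph: a set of `k` edges such that no two distinct ones
have a common end. -/
def IsMatchingOfSize {α β : Type*} (G : Graph α β) (k : ℕ) (M : Finset β) : Prop :=
  (M : Set β) ⊆ G.edgeSet ∧ M.card = k ∧
    ∀ e ∈ M, ∀ f ∈ M, e ≠ f → ∀ x, ¬ (G.Inc e x ∧ G.Inc f x)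

/-- The number of `k`-matchings (for graphs with finitely many edges). Parallel edges are different
edges, so that matchings using different parallel edges are counted separately. -/
noncomputable def numMatchings {α β : Type*} (G : Graph α β) (k : ℕ) : ℕ :=
  {M : Finset β | G.IsMatchingOfSize k M}.ncard

end Graph

/-- The function `𝔾_d(p) = (p ln (d/p) + (d-p) ln (1-p/d) - 2(1-p) ln (1-p)) / 2` for `d ≥ 1` and
`0 ≤ p ≤ 1`. Since `Real.log 0 = 0`, a term with a vanishing factor in front of the logarithm
vanishes, which is the usual convention `0 ln 0 = 0`. -/
noncomputable def entropyG (d : ℕ) (p : ℝ) : ℝ :=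
  (1 / 2) * (p * Real.log (d / p) + (d - p) * Real.log (1 - p / d)
    - 2 * (1 - p) * Real.log (1 - p))

/-- The probability that a random variable with distribution `Binomial(n, p)`, where `p = k / n`,
takes its mean value `k` (for `k ≤ n` and `1 ≤ n`). -/
noncomputable def binomialMeanProb (n k : ℕ) : ℝ :=
  (n.choose k : ℝ) * ((k : ℝ) / n) ^ k * (1 - (k : ℝ) / n) ^ (n - k)

/-! The lower bound is a capacity argument in the manner of Gurvits. Give every edge weight `t` and
split each right vertex `u` into leaves, one per edge, carrying a common variable `x u`. The split
graph is a union of stars, so its partition function is an explicit product, and AM-GM bounds it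
below by a constant times `∏ x u ^ p` (`splitSum_empty_ge`). Right vertices are then glued back one
at a time. As a polynomial in `x j`, the partition function has degree at most `d` and, by
Heilmann-Lieb (`matchingSum_ne_zero`), only negative real roots. Gluing replaces it by the sum of
its coefficients of degrees 0 and 1, which multiplies the capacity by at least `capacityFactor d p`
(`capacity_step`). With everything glued, the matching generating polynomial is at least `exp (2 n
𝔾_d(p)) * t ^ (n p)` for all `t > 0` and `0 < p < 1` (`matchingSum_const_ge`).

To pass from values to a single coefficient, note that the generating polynomial is itself
real-rooted. By Newton's inequalities its coefficients divided by `n.choose i` are log-concave, so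
they lie below a geometric sequence that touches them at `k`. This bounds the polynomial by a
multiple of an `n`-th power of a linear one, and the best `t` produces the factor `p_μ`
(`normCoeff_ge_of_capacity`). Friedland's bound is smaller by a further factor `p_μ ≤ 1`.

For the converse, half-edges are paired by a random permutation. The mean number of `k`-matchings is
`(n.choose k * d ^ k) ^ 2 / (d * n).choose k`, and some permutation does not exceed it. The
comparison with `p_μ exp (2 n 𝔾_d(p))` becomes an inequality between ratios of Stirling's sequence,
which holds because the decrements of its logarithm decrease (`choose_mul_pow_le`). -/

namespace BipartiteMatching

/-! ### Matching sums and their recursions. -/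

open Finset

variable {ε α β K : Type*}

open Classical in
/-- The matchings contained in the finite edge set `F`, where the edge `e` joins `l e` on the left
side to `r e` on the right side. -/
noncomputable def matchings (l : ε → α) (r : ε → β) (F : Finset ε) : Finset (Finset ε) :=
  F.powerset.filter fun M => Set.InjOn l M ∧ Set.InjOn r M

/-- The weighted matching sum (monomer-dimer partition function) of the edge set `F`. -/
noncomputable def matchingSum [CommSemiring K] (w : ε → K) (l : ε → α) (r : ε → β)
    (F : Finset ε) : K :=
  ∑ M ∈ matchings l r F, ∏ e ∈ M, w e

theorem mem_matchings {l : ε → α} {r : ε → β} {F M : Finset ε} :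
    M ∈ matchings l r F ↔ M ⊆ F ∧ Set.InjOn l M ∧ Set.InjOn r M := by
  classical
  simp [matchings]

theorem matchings_swap (l : ε → α) (r : ε → β) (F : Finset ε) :
    matchings r l F = matchings l r F := by
  ext M
  simp [mem_matchings, and_comm]

section Semiring

variable [CommSemiring K]

theorem matchingSum_swap (w : ε → K) (l : ε → α) (r : ε → β) (F : Finset ε) :
    matchingSum w r l F = matchingSum w l r F := by
  simp [matchingSum, matchings_swap l r F]

theorem matchingSum_empty (w : ε → K) (l : ε → α) (r : ε → β) :
    matchingSum w l r ∅ = 1 := by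
  have : matchings l r ∅ = {∅} := by
    ext M
    rw [mem_matchings]
    simp only [subset_empty, mem_singleton, and_iff_left_iff_imp]
    rintro rfl
    simp
  simp [matchingSum, this]

theorem matchingSum_congr {w w' : ε → K} {l : ε → α} {r : ε → β} {F : Finset ε}
    (h : ∀ e ∈ F, w e = w' e) : matchingSum w l r F = matchingSum w' l r F :=
  sum_congr rfl fun _ hM => prod_congr rfl fun e he => h e ((mem_matchings.1 hM).1 he)

theorem map_matchingSum {K' : Type*} [CommSemiring K'] (φ : K →+* K') (w : ε → K) (l : ε → α)
    (r : ε → β) (F : Finset ε) :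
    φ (matchingSum w l r F) = matchingSum (fun e => φ (w e)) l r F := by
  simp [matchingSum, map_sum, map_prod]

theorem matchingSum_insert [DecidableEq ε] [DecidableEq α] [DecidableEq β] (w : ε → K)
    (l : ε → α) (r : ε → β) {F : Finset ε} {e : ε} (he : e ∉ F) :
    matchingSum w l r (insert e F) = matchingSum w l r F +
      w e * matchingSum w l r (F.filter fun f => l f ≠ l e ∧ r f ≠ r e) := by
  classical
  have hp : (F.filter fun f => l f ≠ l e ∧ r f ≠ r e).powerset =
      F.powerset.filter fun M => ∀ f ∈ M, l f ≠ l e ∧ r f ≠ r e := by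
    ext M
    simp only [mem_powerset, mem_filter, subset_iff]
    grind
  unfold matchingSum matchings
  rw [hp, filter_filter]
  simp only [sum_filter, mul_sum]
  rw [sum_powerset_insert he]
  congr 1
  refine sum_congr rfl fun M hM => ?_
  have heM : e ∉ M := fun h => he (mem_powerset.1 hM h)
  have hiff : (Set.InjOn l ↑(insert e M) ∧ Set.InjOn r ↑(insert e M)) ↔
      (∀ f ∈ M, l f ≠ l e ∧ r f ≠ r e) ∧ Set.InjOn l ↑M ∧ Set.InjOn r ↑M := by
    rw [coe_insert, Set.injOn_insert (by simpa using heM), Set.injOn_insert (by simpa using heM)]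
    simp only [Set.mem_image, mem_coe, not_exists, not_and]
    grind
  simp only [hiff, prod_insert heM, mul_ite, mul_zero]

/-- Expansion of the matching sum at a left vertex. -/
theorem matchingSum_expand_left [DecidableEq ε] [DecidableEq α] [DecidableEq β] (w : ε → K)
    (l : ε → α) (r : ε → β) (F : Finset ε) (v : α) :
    matchingSum w l r F = matchingSum w l r (F.filter fun f => l f ≠ v) +
      ∑ e ∈ F.filter (fun f => l f = v),
        w e * matchingSum w l r ((F.filter fun f => l f ≠ v).filter fun f => r f ≠ r e) := by
  have key : ∀ D F' : Finset ε, (∀ e ∈ D, l e = v) → (∀ e ∈ F', l e ≠ v) →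
      matchingSum w l r (D ∪ F') = matchingSum w l r F' +
        ∑ e ∈ D, w e * matchingSum w l r (F'.filter fun f => r f ≠ r e) := by
    intro D F' hD hF'
    induction D using Finset.induction_on with
    | empty => simp
    | insert e D heD ih =>
      have he : e ∉ D ∪ F' := by
        simp only [mem_union, not_or]
        exact ⟨heD, fun h => hF' e h (hD e (mem_insert_self _ _))⟩
      rw [insert_union, matchingSum_insert w l r he, ih fun f hf => hD f (mem_insert_of_mem hf),
        sum_insert heD]
      have : (D ∪ F').filter (fun f => l f ≠ l e ∧ r f ≠ r e) = F'.filter fun f => r f ≠ r e := by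
        ext f
        have := hD e (mem_insert_self _ _)
        simp only [mem_filter, mem_union]
        grind
      rw [this]
      ring
  have := key (F.filter fun f => l f = v) (F.filter fun f => l f ≠ v) (by simp) (by simp)
  rwa [filter_union_filter_not_eq] at this

/-- Expansion of the matching sum at a right vertex. -/
theorem matchingSum_expand_right [DecidableEq ε] [DecidableEq α] [DecidableEq β] (w : ε → K)
    (l : ε → α) (r : ε → β) (F : Finset ε) (u : β) :
    matchingSum w l r F = matchingSum w l r (F.filter fun f => r f ≠ u) +
      ∑ e ∈ F.filter (fun f => r f = u),
        w e * matchingSum w l r ((F.filter fun f => r f ≠ u).filter fun f => l f ≠ l e) := by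
  rw [← matchingSum_swap, matchingSum_expand_left w r l F u]
  simp only [matchingSum_swap w l r]

/-- When right ends are distinct the graph is a disjoint union of stars, and a matching chooses at
most one edge at each centre independently. -/
theorem matchingSum_of_injOn_right [DecidableEq α] (w : ε → K) (l : ε → α) (r : ε → β)
    (F : Finset ε) (hr : Set.InjOn r F) (L : Finset α) (hL : ∀ e ∈ F, l e ∈ L) :
    matchingSum w l r F = ∏ v ∈ L, (1 + ∑ e ∈ F.filter (fun f => l f = v), w e) := by
  classical
  induction L using Finset.induction_on generalizing F with
  | empty =>
    have : F = ∅ := eq_empty_of_forall_notMem fun e he => by simpa using hL e he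
    subst this
    simp [matchingSum_empty]
  | insert v L hv ih =>
    rw [matchingSum_expand_left w l r F v, prod_insert hv]
    have h1 : ∀ e ∈ F.filter (fun f => l f = v),
        w e * matchingSum w l r ((F.filter fun f => l f ≠ v).filter fun f => r f ≠ r e) =
        w e * matchingSum w l r (F.filter fun f => l f ≠ v) := by
      intro e he
      congr 2
      refine filter_true_of_mem fun f hf hfe => ?_
      rw [mem_filter] at he hf
      exact hf.2 (hr hf.1 he.1 hfe ▸ he.2)
    rw [sum_congr rfl h1, ← sum_mul, ih (F.filter fun f => l f ≠ v)
      (hr.mono fun f hf => (mem_filter.1 hf).1) (fun e he => by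
        have := mem_filter.1 he
        exact mem_of_mem_insert_of_ne (hL e this.1) this.2)]
    have h2 : ∏ u ∈ L, (1 + ∑ e ∈ (F.filter fun f => l f ≠ v).filter (fun f => l f = u), w e) =
        ∏ u ∈ L, (1 + ∑ e ∈ F.filter (fun f => l f = u), w e) := by
      refine prod_congr rfl fun u hu => ?_
      rw [filter_filter]
      congr 2
      refine filter_congr fun f _ => ?_
      grind
    rw [h2]
    ring

end Semiring

/-! ### The Heilmann-Lieb theorem. -/

theorem re_inv_pos {z : ℂ} (hz : 0 < z.re) : 0 < (z⁻¹).re := by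
  rw [Complex.inv_re]
  exact div_pos hz (Complex.normSq_pos.2 fun h => by simp [h] at hz)

/-- The Heilmann-Lieb theorem in the bipartite case: the matching sum does not vanish when all
vertex weights have positive real part. -/
theorem matchingSum_ne_zero (c : ε → ℝ) (l : ε → α) (r : ε → β) (y : α → ℂ) (x : β → ℂ)
    (hc : ∀ e, 0 ≤ c e) (hy : ∀ v, 0 < (y v).re) (hx : ∀ u, 0 < (x u).re) (F : Finset ε) :
    matchingSum (fun e => (c e : ℂ) * (y (l e) * x (r e))) l r F ≠ 0 := by
  classical
  set Z : Finset ε → ℂ := matchingSum (fun e => (c e : ℂ) * (y (l e) * x (r e))) l r with hZ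
  have hy0 : ∀ v, y v ≠ 0 := fun v h => by simpa [h] using hy v
  have hx0 : ∀ v, x v ≠ 0 := fun v h => by simpa [h] using hx v
  -- Nonvanishing alone does not propagate. The induction also carries that `Z F / (y v * Z (F -
  -- v))` lies in the right half-plane: expanding at `v` writes it as `(y v)⁻¹` plus nonnegative
  -- multiples of inverses of such ratios for smaller graphs.
  suffices H : ∀ N : ℕ, ∀ F : Finset ε, F.card = N → Z F ≠ 0 ∧
      (∀ v, 0 < (Z F / (y v * Z (F.filter fun f => l f ≠ v))).re) ∧
      (∀ u, 0 < (Z F / (x u * Z (F.filter fun f => r f ≠ u))).re) from (H _ F rfl).1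
  intro N
  induction N using Nat.strong_induction_on with
  | _ N IH =>
  intro F hF
  have hlt : ∀ p : ε → Prop, [DecidablePred p] → (∃ e ∈ F, ¬ p e) → (F.filter p).card < N := by
    intro p _ ⟨e, he, hpe⟩
    rw [← hF]
    exact card_lt_card (filter_ssubset.2 ⟨e, he, hpe⟩)
  have hl : ∀ v, Z (F.filter fun f => l f ≠ v) ≠ 0 →
      0 < (Z F / (y v * Z (F.filter fun f => l f ≠ v))).re := by
    intro v h0
    have hexp : Z F / (y v * Z (F.filter fun f => l f ≠ v)) = (y v)⁻¹ +
        ∑ e ∈ F.filter (fun f => l f = v), (c e : ℂ) *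
          (Z (F.filter fun f => l f ≠ v) / (x (r e) *
            Z ((F.filter fun f => l f ≠ v).filter fun f => r f ≠ r e)))⁻¹ := by
      have h1 : Z F = _ := matchingSum_expand_left _ l r F v
      rw [← hZ] at h1
      rw [h1, add_div, sum_div]
      congr 1
      · have := hy0 v
        field_simp
      · refine sum_congr rfl fun e he => ?_
        rw [(mem_filter.1 he).2, inv_div]
        have := hy0 v
        field_simp
    rw [hexp, Complex.add_re, Complex.re_sum]
    refine add_pos_of_pos_of_nonneg (re_inv_pos (hy v)) (sum_nonneg fun e he => ?_)
    rw [Complex.re_ofReal_mul]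
    have := (IH _ (hlt (fun f => l f ≠ v) ⟨e, (mem_filter.1 he).1, by
      simpa using (mem_filter.1 he).2⟩) _ rfl).2.2 (r e)
    exact mul_nonneg (hc e) (re_inv_pos this).le
  have hr : ∀ u, Z (F.filter fun f => r f ≠ u) ≠ 0 →
      0 < (Z F / (x u * Z (F.filter fun f => r f ≠ u))).re := by
    intro u h0
    have hexp : Z F / (x u * Z (F.filter fun f => r f ≠ u)) = (x u)⁻¹ +
        ∑ e ∈ F.filter (fun f => r f = u), (c e : ℂ) *
          (Z (F.filter fun f => r f ≠ u) / (y (l e) *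
            Z ((F.filter fun f => r f ≠ u).filter fun f => l f ≠ l e)))⁻¹ := by
      have h1 : Z F = _ := matchingSum_expand_right _ l r F u
      rw [← hZ] at h1
      rw [h1, add_div, sum_div]
      congr 1
      · have := hx0 u
        field_simp
      · refine sum_congr rfl fun e he => ?_
        rw [(mem_filter.1 he).2, inv_div]
        have := hx0 u
        field_simp
    rw [hexp, Complex.add_re, Complex.re_sum]
    refine add_pos_of_pos_of_nonneg (re_inv_pos (hx u)) (sum_nonneg fun e he => ?_)
    rw [Complex.re_ofReal_mul]
    have := (IH _ (hlt (fun f => r f ≠ u) ⟨e, (mem_filter.1 he).1, by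
      simpa using (mem_filter.1 he).2⟩) _ rfl).2.1 (l e)
    exact mul_nonneg (hc e) (re_inv_pos this).le
  have h0 : Z F ≠ 0 := by
    rcases F.eq_empty_or_nonempty with rfl | ⟨e, he⟩
    · simp [hZ, matchingSum_empty]
    · have h1 := hl (l e) (IH _ (hlt (fun f => l f ≠ l e) ⟨e, he, by simp⟩) _ rfl).1
      intro h
      simp [h] at h1
  -- Deleting a vertex without edges leaves `F` unchanged; then `h0` serves instead of the induction
  -- hypothesis.
  have hsub : ∀ p : ε → Prop, [DecidablePred p] → Z (F.filter p) ≠ 0 := by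
    intro p _
    by_cases h : ∃ e ∈ F, ¬ p e
    · exact (IH _ (hlt p h) _ rfl).1
    · push Not at h
      rwa [filter_true_of_mem h]
  exact ⟨h0, fun v => hl v (hsub _), fun u => hr u (hsub _)⟩

end BipartiteMatching

namespace BipartiteMatching

open Finset

/-! ### Real-rooted polynomials as products of linear factors. -/

section RealRooted

open Polynomial

/-- A real polynomial whose complex roots are all negative reals is a product of linear factors
with nonnegative coefficients. -/
theorem exists_eq_prod_linear (d : ℕ) (f : ℝ[X]) (h0 : f.eval 0 ≠ 0)
    (hroot : ∀ z ∈ Complex.slitPlane, aeval z f ≠ 0) (hdeg : f.natDegree ≤ d) :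
    ∃ c : ℕ → ℝ, (∀ i, 0 ≤ c i) ∧ f = C (f.eval 0) * ∏ i ∈ range d, (1 + C (c i) * X) := by
  induction d generalizing f with
  | zero =>
    refine ⟨0, fun _ => le_rfl, ?_⟩
    obtain ⟨a, rfl⟩ := natDegree_eq_zero.1 (Nat.le_zero.1 hdeg)
    simp
  | succ d ih =>
    by_cases hd : f.natDegree = 0
    · refine ⟨0, fun _ => le_rfl, ?_⟩
      obtain ⟨a, rfl⟩ := natDegree_eq_zero.1 hd
      simp
    have hf0 : f ≠ 0 := by
      rintro rfl
      simp at h0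
    obtain ⟨z, hz⟩ := Complex.exists_root (f := f.map (algebraMap ℝ ℂ)) (by
      rw [degree_map]
      exact natDegree_pos_iff_degree_pos.1 (Nat.pos_of_ne_zero hd))
    have hz' : aeval z f = 0 := by
      rw [aeval_def, ← eval_map]
      exact hz
    have hzs : z ∉ Complex.slitPlane := fun h => hroot z h hz'
    rw [Complex.mem_slitPlane_iff] at hzs
    push Not at hzs
    have hzr : z = ((z.re : ℝ) : ℂ) := Complex.ext rfl (by simpa using hzs.2)
    have hre : f.eval z.re = 0 := by
      rw [hzr, Complex.coe_algebraMap.symm, aeval_algebraMap_apply] at hz'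
      simpa using hz'
    have hneg : z.re < 0 := lt_of_le_of_ne hzs.1 fun h => h0 (h ▸ hre)
    obtain ⟨q, hq⟩ := dvd_iff_isRoot.2 hre
    have hq0 : q ≠ 0 := by
      rintro rfl
      simp [hq] at hf0
    have hqe : f.eval 0 = -z.re * q.eval 0 := by
      rw [hq]
      simp
    obtain ⟨c, hc, hcq⟩ := ih q (fun h => h0 (by rw [hqe, h, mul_zero]))
      (fun w hw h => hroot w hw (by rw [hq, map_mul, h, mul_zero])) (by
        have h1 : f.natDegree = _ := congrArg natDegree hq
        rw [natDegree_mul (X_sub_C_ne_zero _) hq0, natDegree_X_sub_C] at h1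
        omega)
    -- The new factor comes from `X - z = -z * (1 - z⁻¹ * X)` with `z < 0`; its constant `-z` is
    -- absorbed by the value at 0.
    refine ⟨Function.update c d (-(z.re)⁻¹), fun i => ?_, ?_⟩
    · rcases eq_or_ne i d with rfl | hi
      · simpa using hneg.le
      · simpa [hi] using hc i
    · have h1 : ∏ i ∈ range d, (1 + C (Function.update c d (-(z.re)⁻¹) i) * X) =
          ∏ i ∈ range d, (1 + C (c i) * X) := by
        refine prod_congr rfl fun i hi => ?_
        rw [Function.update_of_ne (mem_range.1 hi).ne]
      rw [prod_range_succ, h1, Function.update_self, hqe, C_mul]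
      have h2 : C (-z.re) * (1 + C (-(z.re)⁻¹) * X) = (X - C z.re : ℝ[X]) := by
        rw [mul_add, ← mul_assoc, ← C_mul]
        have : -z.re * -(z.re)⁻¹ = 1 := by
          field_simp [hneg.ne]
        rw [this]
        simp
        ring
      calc f = (X - C z.re) * q := hq
        _ = (C (-z.re) * (1 + C (-(z.re)⁻¹) * X)) *
            (C (q.eval 0) * ∏ i ∈ range d, (1 + C (c i) * X)) := by rw [h2, ← hcq]
        _ = _ := by ring

theorem coeff_one_prod_linear (c : ℕ → ℝ) (d : ℕ) :
    (∏ i ∈ range d, (1 + C (c i) * X)).coeff 1 = ∑ i ∈ range d, c i := by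
  have h0 : ∀ d, (∏ i ∈ range d, (1 + C (c i) * X)).coeff 0 = 1 := fun d => by
    simp [coeff_zero_eq_eval_zero, eval_prod]
  induction d with
  | zero => simp [coeff_one]
  | succ d ih =>
    rw [prod_range_succ, sum_range_succ, mul_add, mul_one, coeff_add, ih, ← mul_assoc,
      coeff_mul_X, coeff_mul_C, h0, one_mul]

/-- A product of `d` linear factors is at most the `d`-th power of their mean. -/
theorem eval_prod_linear_le (c : ℕ → ℝ) (hc : ∀ i, 0 ≤ c i) {d : ℕ} (hd : d ≠ 0) {u : ℝ}
    (hu : 0 ≤ u) :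
    (∏ i ∈ range d, (1 + C (c i) * X)).eval u ≤ (1 + (∑ i ∈ range d, c i) * u / d) ^ d := by
  have hd' : (0 : ℝ) < d := by exact_mod_cast Nat.pos_of_ne_zero hd
  set m : ℝ := 1 + (∑ i ∈ range d, c i) * u / d with hm
  have hm0 : 0 < m := by
    have := mul_nonneg (sum_nonneg fun i (_ : i ∈ range d) => hc i) hu
    positivity
  -- AM-GM by hand: after division by the mean the factors average to 1, and `y ≤ exp (y - 1)`
  -- bounds their product by 1.
  have hsum : ∑ i ∈ range d, ((1 + c i * u) / m - 1) = 0 := by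
    rw [sum_sub_distrib, ← sum_div, sum_add_distrib, ← sum_mul]
    simp only [sum_const, card_range, nsmul_eq_mul, mul_one]
    rw [sub_eq_zero, div_eq_iff hm0.ne', hm]
    field_simp
  have h1 : ∏ i ∈ range d, ((1 + c i * u) / m) ≤ 1 := by
    calc ∏ i ∈ range d, ((1 + c i * u) / m)
        ≤ ∏ i ∈ range d, Real.exp ((1 + c i * u) / m - 1) := by
          refine prod_le_prod (fun i _ => ?_) fun i _ => ?_
          · have := mul_nonneg (hc i) hu
            positivity
          · have := Real.add_one_le_exp ((1 + c i * u) / m - 1)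
            linarith
      _ = 1 := by rw [← Real.exp_sum, hsum, Real.exp_zero]
  rw [prod_div_distrib, prod_const, card_range, div_le_one (pow_pos hm0 d)] at h1
  simpa [eval_prod] using h1

end RealRooted

/-! ### Newton's inequalities and coefficient bounds from capacity. -/

section Newton

/-- The coefficients of `∏ i < m, (1 + c i * X)` divided by the binomial coefficients. -/
noncomputable def normCoeff (c : ℕ → ℝ) : ℕ → ℕ → ℝ
  | 0, 0 => 1
  | 0, _ + 1 => 0
  | _ + 1, 0 => 1
  | m + 1, k + 1 =>
    (((m : ℝ) - k) * normCoeff c m (k + 1) + (k + 1) * c m * normCoeff c m k) / (m + 1)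

theorem normCoeff_zero_right (c : ℕ → ℝ) (m : ℕ) : normCoeff c m 0 = 1 := by
  cases m <;> rfl

theorem normCoeff_of_lt (c : ℕ → ℝ) (m k : ℕ) (h : m < k) : normCoeff c m k = 0 := by
  induction m generalizing k with
  | zero =>
    obtain ⟨k, rfl⟩ := Nat.exists_eq_succ_of_ne_zero h.ne'
    rfl
  | succ m ih =>
    obtain ⟨k, rfl⟩ := Nat.exists_eq_succ_of_ne_zero (Nat.zero_lt_of_lt h).ne'
    simp only [normCoeff, ih (k + 1) (by omega), ih k (by omega)]
    simp

theorem normCoeff_self (c : ℕ → ℝ) (m : ℕ) : normCoeff c m m = ∏ i ∈ range m, c i := by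
  induction m with
  | zero => rfl
  | succ m ih =>
    simp only [normCoeff, sub_self, zero_mul, zero_add, ih, prod_range_succ]
    field_simp

theorem coeff_prod_linear (c : ℕ → ℝ) (m k : ℕ) :
    (∏ i ∈ range m, (1 + Polynomial.C (c i) * Polynomial.X)).coeff k =
      m.choose k * normCoeff c m k := by
  induction m generalizing k with
  | zero => cases k <;> simp [normCoeff, Polynomial.coeff_one]
  | succ m ih =>
    rw [prod_range_succ, mul_add, mul_one, Polynomial.coeff_add, ← mul_assoc, ih]
    cases k with
    | zero => simp [normCoeff_zero_right]
    | succ k =>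
      rw [Polynomial.coeff_mul_X, Polynomial.coeff_mul_C, ih]
      have h1 : ((m + 1).choose (k + 1) : ℝ) * (k + 1) = (m + 1) * m.choose k := by
        exact_mod_cast (Nat.add_one_mul_choose_eq m k).symm
      have h2 : ((m + 1).choose (k + 1) : ℝ) * (m - k) = (m + 1) * m.choose (k + 1) := by
        have h3 : ((m + 1).choose (k + 1) : ℝ) = m.choose k + m.choose (k + 1) := by
          exact_mod_cast Nat.choose_succ_succ m k
        linear_combination -h1 + (m + 1 : ℝ) * h3
      simp only [normCoeff]
      field_simp
      linear_combination (-normCoeff c m (k + 1)) * h2 - (c m * normCoeff c m k) * h1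

theorem normCoeff_pos (c : ℕ → ℝ) (m k : ℕ) (hc : ∀ i < m, 0 < c i) (h : k ≤ m) :
    0 < normCoeff c m k := by
  induction m generalizing k with
  | zero =>
    obtain rfl := Nat.le_zero.1 h
    exact one_pos
  | succ m ih =>
    cases k with
    | zero => exact one_pos
    | succ k =>
      have hkm : k ≤ m := by omega
      have h1 := ih k (fun i hi => hc i (by omega)) hkm
      have h2 : 0 ≤ normCoeff c m (k + 1) := by
        rcases lt_or_ge m (k + 1) with h' | h'
        · exact (normCoeff_of_lt c m _ h').ge
        · exact (ih _ (fun i hi => hc i (by omega)) h').le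
      have h3 : (k : ℝ) ≤ m := by exact_mod_cast hkm
      have h4 := hc m (by omega)
      simp only [normCoeff]
      have := mul_nonneg (sub_nonneg.2 h3) h2
      positivity

theorem normCoeff_nonneg (c : ℕ → ℝ) (m k : ℕ) (hc : ∀ i < m, 0 < c i) :
    0 ≤ normCoeff c m k := by
  rcases lt_or_ge m k with h | h
  · exact (normCoeff_of_lt c m _ h).ge
  · exact (normCoeff_pos c m k hc h).le

/-- Right side minus left side is a nonnegative combination of the three hypotheses plus the square
`(x₂ - c * x₁) ^ 2`. The factor `j` in `h₂` and `h₃` makes them vacuous for `j = 0`, where `x₀`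
would be a coefficient of index -1. -/
theorem newton_step {a j c x₀ x₁ x₂ x₃ : ℝ} (ha : 1 ≤ a) (hj : 0 ≤ j) (hc : 0 ≤ c)
    (h₁ : x₁ * x₃ ≤ x₂ ^ 2) (h₂ : j * (x₀ * x₂) ≤ j * x₁ ^ 2)
    (h₃ : j * (x₀ * x₃) ≤ j * (x₁ * x₂)) :
    ((a + 1) * x₁ + j * c * x₀) * ((a - 1) * x₃ + (j + 2) * c * x₂) ≤
      (a * x₂ + (j + 1) * c * x₁) ^ 2 := by
  have e₁ := mul_le_mul_of_nonneg_left h₁ (mul_nonneg (by linarith : 0 ≤ a + 1)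
    (by linarith : 0 ≤ a - 1))
  have e₂ := mul_le_mul_of_nonneg_left h₂ (mul_nonneg (sq_nonneg c) (by linarith : 0 ≤ j + 2))
  have e₃ := mul_le_mul_of_nonneg_left h₃ (mul_nonneg hc (by linarith : 0 ≤ a - 1))
  have e₄ := sq_nonneg (x₂ - c * x₁)
  linarith

/-- Newton's inequalities. -/
theorem normCoeff_newton (c : ℕ → ℝ) (m k : ℕ) (hc : ∀ i < m, 0 < c i) :
    normCoeff c m k * normCoeff c m (k + 2) ≤ normCoeff c m (k + 1) ^ 2 := by
  induction m generalizing k with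
  | zero => simp [normCoeff]
  | succ m ih =>
    rcases lt_or_ge m (k + 1) with h | h
    · rw [normCoeff_of_lt c (m + 1) (k + 2) (by omega), mul_zero]
      positivity
    have hc' : ∀ i < m, 0 < c i := fun i hi => hc i (by omega)
    have hm : (0 : ℝ) < m + 1 := by positivity
    have ha : (1 : ℝ) ≤ (m : ℝ) - k := by
      have : ((k + 1 : ℕ) : ℝ) ≤ m := by exact_mod_cast h
      push_cast at this
      linarith
    -- Here `y` plays the role of `normCoeff c m (k - 1)`; for `k = 0` it is multiplied by 0 and may
    -- be anything.
    have hfin : ∀ y : ℝ, normCoeff c (m + 1) k = ((((m : ℝ) - k) + 1) * normCoeff c m k +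
          k * c m * y) / (m + 1) →
        (k : ℝ) * (y * normCoeff c m (k + 1)) ≤ k * normCoeff c m k ^ 2 →
        (k : ℝ) * (y * normCoeff c m (k + 2)) ≤ k * (normCoeff c m k * normCoeff c m (k + 1)) →
        normCoeff c (m + 1) k * normCoeff c (m + 1) (k + 2) ≤ normCoeff c (m + 1) (k + 1) ^ 2 := by
      intro y hy h2 h3
      have := newton_step ha (Nat.cast_nonneg k) (hc m (by omega)).le (ih k hc') h2 h3
      have e1 : normCoeff c (m + 1) (k + 1) = (((m : ℝ) - k) * normCoeff c m (k + 1) +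
          (k + 1) * c m * normCoeff c m k) / (m + 1) := by
        simp only [normCoeff]
      have e2 : normCoeff c (m + 1) (k + 2) = ((((m : ℝ) - k) - 1) * normCoeff c m (k + 2) +
          (k + 2) * c m * normCoeff c m (k + 1)) / (m + 1) := by
        simp only [normCoeff]
        push_cast
        ring
      rw [hy, e1, e2, div_mul_div_comm, div_pow, ← sq]
      gcongr
    cases k with
    | zero =>
      refine hfin 0 ?_ (by simp) (by simp)
      simp only [normCoeff_zero_right]
      simp
      field_simp
    | succ j =>
      have hp : ∀ i ≤ m, 0 < normCoeff c m i := fun i hi => normCoeff_pos c m i hc' hi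
      refine hfin (normCoeff c m j) ?_ (mul_le_mul_of_nonneg_left (ih j hc') (by positivity))
        (mul_le_mul_of_nonneg_left ?_ (by positivity))
      · simp only [normCoeff]
        push_cast
        ring
      · have h0 := hp j (by omega)
        have h1 := hp (j + 1) (by omega)
        have h2 := hp (j + 2) (by omega)
        have h3 := normCoeff_nonneg c m (j + 3) hc'
        have i0 := ih j hc'
        have i1 := ih (j + 1) hc'
        -- The product of two consecutive Newton inequalities, from which the positive middle factor
        -- cancels.
        have : normCoeff c m j * normCoeff c m (j + 3) *
            (normCoeff c m (j + 1) * normCoeff c m (j + 2)) ≤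
            normCoeff c m (j + 1) * normCoeff c m (j + 2) *
            (normCoeff c m (j + 1) * normCoeff c m (j + 2)) := by
          have := mul_le_mul i0 i1 (by positivity) (by positivity)
          linarith
        exact le_of_mul_le_mul_right this (by positivity)

theorem eval_prod_linear_eq_sum (c : ℕ → ℝ) (n : ℕ) (t : ℝ) :
    ∏ i ∈ range n, (1 + c i * t) =
      ∑ i ∈ range (n + 1), (n.choose i : ℝ) * normCoeff c n i * t ^ i := by
  have h : (∏ i ∈ range n, (1 + Polynomial.C (c i) * Polynomial.X)).eval t =
      ∏ i ∈ range n, (1 + c i * t) := by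
    simp [Polynomial.eval_prod]
  rw [← h, Polynomial.eval_eq_sum_range' (n := n + 1)]
  · simp only [coeff_prod_linear]
  · refine Nat.lt_succ_of_le (Polynomial.natDegree_le_iff_coeff_eq_zero.2 fun N hN => ?_)
    rw [coeff_prod_linear, Nat.choose_eq_zero_of_lt hN]
    simp

/-- By log-concavity consecutive ratios decrease, so the sequence lies below the geometric one
through its terms at `k` and `k + 1`. Multiplying by `ρ ^ k` avoids negative exponents when `i < k`.
-/
theorem normCoeff_mul_pow_le (c : ℕ → ℝ) (n k i : ℕ) (hc : ∀ i < n, 0 < c i) (hk : k < n)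
    (hi : i ≤ n) :
    normCoeff c n i * (normCoeff c n (k + 1) / normCoeff c n k) ^ k ≤
      normCoeff c n k * (normCoeff c n (k + 1) / normCoeff c n k) ^ i := by
  set E := normCoeff c n with hE
  have hp : ∀ i ≤ n, 0 < E i := fun i hi => normCoeff_pos c n i hc hi
  have hn : ∀ i, 0 ≤ E i := fun i => normCoeff_nonneg c n i hc
  have hanti : Antitone fun i => E (i + 1) / E i := by
    refine antitone_nat_of_succ_le fun i => ?_
    rcases lt_or_ge n (i + 1) with h | h
    · rw [show E (i + 1) = 0 from normCoeff_of_lt c n _ h]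
      simp
    · rw [div_le_div_iff₀ (hp _ h) (hp _ (by omega))]
      have := normCoeff_newton c n i hc
      rw [← hE] at this
      linarith
  set ρ := E (k + 1) / E k with hρ
  have hρ0 : 0 < ρ := div_pos (hp _ hk) (hp _ hk.le)
  have hstep : ∀ i ≤ n, E (i + 1) = E (i + 1) / E i * E i := fun i hi => by
    rw [div_mul_cancel₀ _ (hp i hi).ne']
  have hup : ∀ j, k + j ≤ n → E (k + j) ≤ E k * ρ ^ j := by
    intro j
    induction j with
    | zero => simp
    | succ j ih =>
      intro hj
      rw [← add_assoc, hstep (k + j) (by omega), pow_succ]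
      have h1 : E (k + j + 1) / E (k + j) ≤ ρ := hanti (Nat.le_add_right k j)
      have h2 := ih (by omega)
      calc _ ≤ ρ * (E k * ρ ^ j) := mul_le_mul h1 h2 (hn _) hρ0.le
        _ = _ := by ring
  have hdown : ∀ j i, i + j = k → E i * ρ ^ j ≤ E k := by
    intro j
    induction j with
    | zero =>
      rintro i rfl
      simp
    | succ j ih =>
      intro i hij
      have h1 : ρ ≤ E (i + 1) / E i := hanti (by omega : i ≤ k)
      have h2 := ih (i + 1) (by omega)
      refine le_trans ?_ h2
      rw [hstep i (by omega), pow_succ]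
      have := mul_le_mul_of_nonneg_right h1 (mul_nonneg (hn i) (pow_nonneg hρ0.le j))
      linarith
  rcases le_total k i with h | h
  · obtain ⟨j, rfl⟩ := Nat.exists_eq_add_of_le h
    have := mul_le_mul_of_nonneg_right (hup j hi) (pow_nonneg hρ0.le k)
    rw [pow_add]
    linarith
  · obtain ⟨j, rfl⟩ := Nat.exists_eq_add_of_le h
    have := mul_le_mul_of_nonneg_right (hdown j i rfl) (pow_nonneg hρ0.le i)
    rw [pow_add]
    linarith

/-- Lower bound for a middle coefficient of a real-rooted polynomial in terms of its capacity. -/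
theorem normCoeff_ge_of_capacity (c : ℕ → ℝ) (n k : ℕ) (hc : ∀ i < n, 0 < c i) (hk0 : 0 < k)
    (hk : k < n) (B : ℝ) (hB : ∀ t > 0, B * t ^ k ≤ ∏ i ∈ range n, (1 + c i * t)) :
    B * (((k : ℝ) / n) ^ k * (1 - (k : ℝ) / n) ^ (n - k)) ≤ normCoeff c n k := by
  set E := normCoeff c n with hE
  have hEk : 0 < E k := normCoeff_pos c n k hc hk.le
  set ρ := E (k + 1) / E k with hρ
  have hρ0 : 0 < ρ := div_pos (normCoeff_pos c n _ hc hk) hEk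
  have hnpos : (0 : ℝ) < n := by exact_mod_cast hk0.trans hk
  have hkpos : (0 : ℝ) < k := by exact_mod_cast hk0
  set p : ℝ := (k : ℝ) / n with hp
  have hp0 : 0 < p := by positivity
  have hp1 : 0 < 1 - p := by
    rw [sub_pos, hp, div_lt_one hnpos]
    exact_mod_cast hk
  -- This `t` minimises `(1 + ρ * t) ^ n / t ^ k`: there `ρ * t = p / (1 - p)`, and `1 + ρ * t = (1
  -- - p)⁻¹`.
  have h1 := hB (p / (1 - p) / ρ) (by positivity)
  rw [eval_prod_linear_eq_sum] at h1
  have h2 := mul_le_mul_of_nonneg_right h1 (pow_nonneg hρ0.le k)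
  have h3 : (∑ i ∈ range (n + 1), (n.choose i : ℝ) * normCoeff c n i *
      (p / (1 - p) / ρ) ^ i) * ρ ^ k ≤ E k * (p / (1 - p) + 1) ^ n := by
    rw [add_pow, sum_mul, mul_sum]
    refine sum_le_sum fun i hi => ?_
    have := normCoeff_mul_pow_le c n k i hc hk (Nat.lt_succ_iff.1 (mem_range.1 hi))
    rw [← hE, ← hρ] at this
    have h4 := mul_le_mul_of_nonneg_left this
      (by positivity : 0 ≤ (n.choose i : ℝ) * (p / (1 - p) / ρ) ^ i)
    rw [← hE]
    calc _ = (n.choose i : ℝ) * (p / (1 - p) / ρ) ^ i * (E i * ρ ^ k) := by ring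
      _ ≤ _ := h4
      _ = E k * ((p / (1 - p) / ρ) ^ i * ρ ^ i * 1 ^ (n - i) * n.choose i) := by
        rw [one_pow]
        ring
      _ = _ := by
        rw [← mul_pow, div_mul_cancel₀ _ hρ0.ne']
  have h5 : p / (1 - p) + 1 = (1 - p)⁻¹ := by
    field_simp
    ring
  have h6 := h2.trans h3
  rw [h5, mul_assoc, ← mul_pow, div_mul_cancel₀ _ hρ0.ne', inv_pow, div_pow] at h6
  have h7 : (1 - p) ^ n = (1 - p) ^ k * (1 - p) ^ (n - k) := by
    rw [← pow_add, Nat.add_sub_cancel' hk.le]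
  have h8 := mul_le_mul_of_nonneg_right h6 (pow_nonneg hp1.le n)
  rw [mul_assoc (E k), inv_mul_cancel₀ (pow_pos hp1 n).ne', mul_one] at h8
  refine le_trans (le_of_eq ?_) h8
  rw [h7]
  field_simp

/-- Lower bound for the top coefficient of a real-rooted polynomial in terms of its capacity. -/
theorem prod_ge_of_capacity (c : ℕ → ℝ) (n : ℕ) (B : ℝ)
    (hB : ∀ t > 0, B * t ^ n ≤ ∏ i ∈ range n, (1 + c i * t)) : B ≤ ∏ i ∈ range n, c i := by
  have hcont : Continuous fun s : ℝ => ∏ i ∈ range n, (s + c i) := by fun_prop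
  have h1 : Filter.Tendsto (fun s : ℝ => ∏ i ∈ range n, (s + c i))
      (nhdsWithin 0 (Set.Ioi 0)) (nhds (∏ i ∈ range n, c i)) := by
    have := (hcont.tendsto 0).mono_left (nhdsWithin_le_nhds (s := Set.Ioi 0))
    simpa using this
  -- With `t = s⁻¹`, dividing by `t ^ n` turns the product into `∏ (s + c i)`, and `s → 0` isolates
  -- the top coefficient.
  refine ge_of_tendsto h1 (eventually_nhdsWithin_of_forall fun s (hs : 0 < s) => ?_)
  have h2 := hB s⁻¹ (by positivity)
  have h3 := mul_le_mul_of_nonneg_right h2 (pow_nonneg hs.le n)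
  rw [mul_assoc, ← mul_pow, inv_mul_cancel₀ hs.ne', one_pow, mul_one] at h3
  refine h3.trans (le_of_eq ?_)
  rw [← card_range n, ← prod_const, card_range, ← prod_mul_distrib]
  refine prod_congr rfl fun i _ => ?_
  field_simp

end Newton

end BipartiteMatching

namespace BipartiteMatching

open Finset

variable {ε α β K : Type*}

/-! ### Splitting right vertices into leaves and gluing them back. -/

section Splitting

/-- Only the relation of having equal right ends matters, so `r` may be exchanged for a map into
another type, such as `splitRight`. -/
theorem matchingSum_congr_right [CommSemiring K] {β' : Type*} {w : ε → K} {l : ε → α}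
    {r : ε → β} {r' : ε → β'} {F : Finset ε}
    (h : ∀ e ∈ F, ∀ f ∈ F, r e = r f ↔ r' e = r' f) :
    matchingSum w l r F = matchingSum w l r' F := by
  have : matchings l r F = matchings l r' F := by
    ext M
    rw [mem_matchings, mem_matchings]
    refine and_congr_right fun hM => and_congr_right fun _ => ?_
    refine forall₂_congr fun e he => forall₂_congr fun f hf => ?_
    rw [h e (hM he) f (hM hf)]
  rw [matchingSum, this, matchingSum]

theorem matchingSum_union_eq_of_zero [CommSemiring K] [DecidableEq ε] (w : ε → K) (l : ε → α)
    (r : ε → β) (D F : Finset ε) (h : ∀ e ∈ D, w e = 0) (hDF : Disjoint D F) :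
    matchingSum w l r (D ∪ F) = matchingSum w l r F := by
  classical
  induction D using Finset.induction_on with
  | empty => simp
  | insert e D he ih =>
    rw [disjoint_insert_left] at hDF
    rw [insert_union, matchingSum_insert w l r (by simp [he, hDF.1]), h e (mem_insert_self _ _),
      zero_mul, add_zero, ih (fun f hf => h f (mem_insert_of_mem hf)) hDF.2]

theorem one_le_matchingSum (w : ε → ℝ) (l : ε → α) (r : ε → β) (F : Finset ε)
    (h : ∀ e ∈ F, 0 ≤ w e) : 1 ≤ matchingSum w l r F := by
  have h0 : ∅ ∈ matchings l r F := mem_matchings.2 (by simp)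
  have := single_le_sum (f := fun M => ∏ e ∈ M, w e)
    (fun M hM => prod_nonneg fun e he => h e ((mem_matchings.1 hM).1 he)) h0
  simpa [matchingSum] using this

open Polynomial in
theorem coeff_zero_matchingSum (W : ε → ℝ[X]) (l : ε → α) (r : ε → β) (F : Finset ε) :
    (matchingSum W l r F).coeff 0 = matchingSum (fun e => (W e).coeff 0) l r F := by
  simpa using map_matchingSum constantCoeff W l r F

open Polynomial in
-- Edges of `D` end in leaves and carry the indeterminate. Degree 1 comes from matchings with
-- exactly one of them, and that edge blocks only the edges at its left end.
theorem coeff_one_matchingSum [DecidableEq ε] [DecidableEq α] (W : ε → ℝ[X]) (l : ε → α)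
    (r : ε → β) (D F : Finset ε) (hDF : Disjoint D F)
    (hD : ∀ e ∈ D, (W e).coeff 0 = 0) (hF : ∀ e ∈ F, (W e).coeff 1 = 0 ∧ (W e).natDegree = 0)
    (hr : ∀ e ∈ D, ∀ f ∈ D ∪ F, f ≠ e → r f ≠ r e) :
    (matchingSum W l r (D ∪ F)).coeff 1 = ∑ e ∈ D, (W e).coeff 1 *
      matchingSum (fun e => (W e).coeff 0) l r (F.filter fun f => l f ≠ l e) := by
  classical
  induction D using Finset.induction_on with
  | empty =>
    have : matchingSum W l r F = C (matchingSum (fun e => (W e).coeff 0) l r F) := by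
      rw [map_matchingSum]
      exact matchingSum_congr fun e he => eq_C_of_natDegree_eq_zero (hF e he).2
    simp [this]
  | insert e D he ih =>
    rw [disjoint_insert_left] at hDF
    rw [insert_union, matchingSum_insert W l r (by simp [he, hDF.1]), sum_insert he, coeff_add,
      ih hDF.2 (fun f hf => hD f (mem_insert_of_mem hf)) (fun f hf g hg => hr f
        (mem_insert_of_mem hf) g (by simp only [mem_union, mem_insert] at hg ⊢; tauto)),
      mul_coeff_one, hD e (mem_insert_self _ _), zero_mul, zero_add, coeff_zero_matchingSum]
    have h1 : (D ∪ F).filter (fun f => l f ≠ l e ∧ r f ≠ r e) =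
        D.filter (fun f => l f ≠ l e) ∪ F.filter (fun f => l f ≠ l e) := by
      rw [← filter_union]
      refine filter_congr fun f hf => and_iff_left (hr e (mem_insert_self _ _) f ?_ ?_)
      · simp only [mem_union, mem_insert] at hf ⊢
        tauto
      · rintro rfl
        simp [he, hDF.1] at hf
    rw [h1, matchingSum_union_eq_of_zero]
    · ring
    · exact fun f hf => hD f (mem_insert_of_mem (mem_filter.1 hf).1)
    · exact disjoint_filter_filter hDF.2

theorem exists_sq_eq_of_mem_slitPlane {z : ℂ} (hz : z ∈ Complex.slitPlane) :
    ∃ s : ℂ, s * s = z ∧ 0 < s.re := by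
  have hz0 : z ≠ 0 := Complex.slitPlane_ne_zero hz
  -- The principal square root: halving an argument in `(-π, π)` puts it in the right half-plane.
  refine ⟨Complex.exp (Complex.log z / 2), ?_, ?_⟩
  · rw [← Complex.exp_add, add_halves, Complex.exp_log hz0]
  · rw [Complex.exp_re]
    refine mul_pos (Real.exp_pos _) (Real.cos_pos_of_mem_Ioo ?_)
    have h1 := Complex.neg_pi_lt_arg z
    have h2 := (Complex.arg_le_pi z).lt_of_ne (Complex.slitPlane_arg_ne_pi hz)
    have h3 : (Complex.log z / 2).im = z.arg / 2 := by
      simp [Complex.log_im]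
    rw [h3]
    constructor <;> linarith

open Classical in
/-- Split every right vertex outside `S` into leaves, one for each edge. -/
noncomputable def splitRight (S : Finset β) (r : ε → β) (e : ε) : β ⊕ ε :=
  if r e ∈ S then Sum.inl (r e) else Sum.inr e

open Classical in
/-- Edge weights `t`, multiplied by the vertex variable for the right vertices outside `S`. -/
noncomputable def splitWeight (t : ℝ) (S : Finset β) (x : β → ℝ) (r : ε → β) (e : ε) : ℝ :=
  if r e ∈ S then t else t * x (r e)

/-- The matching sum of the graph in which the right vertices outside `S` are split. -/
noncomputable def splitSum (t : ℝ) (S : Finset β) (x : β → ℝ) (l : ε → α) (r : ε → β)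
    (F : Finset ε) : ℝ :=
  matchingSum (splitWeight t S x r) l (splitRight S r) F

open Polynomial Classical in
/-- `splitWeight` with an indeterminate for the vertex variable at `j`. -/
noncomputable def splitPoly (t : ℝ) (S : Finset β) (x : β → ℝ) (j : β) (r : ε → β) (e : ε) :
    ℝ[X] :=
  if r e = j then C t * X else C (splitWeight t S x r e)

open Polynomial

theorem eval_matchingSum_splitPoly [DecidableEq β] (t : ℝ) (S : Finset β) (x : β → ℝ) {j : β}
    (hj : j ∉ S) (l : ε → α) (r : ε → β) (F : Finset ε) (u : ℝ) :
    (matchingSum (splitPoly t S x j r) l (splitRight S r) F).eval u =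
      splitSum t S (Function.update x j u) l r F := by
  have := map_matchingSum (evalRingHom u) (splitPoly t S x j r) l (splitRight S r) F
  rw [coe_evalRingHom] at this
  rw [this, splitSum]
  refine matchingSum_congr fun e _ => ?_
  simp only [splitPoly, splitWeight]
  by_cases h : r e = j
  · simp [h, hj]
  · simp [h]

/-- A matching of the glued graph uses at most one edge at `j`, whereas a matching of the split
graph may use several leaves of `j`. The first kind are therefore counted by degrees 0 and 1. -/
theorem coeff_matchingSum_splitPoly [DecidableEq β] (t : ℝ) (S : Finset β) (x : β → ℝ) {j : β}
    (hj : j ∉ S) (l : ε → α) (r : ε → β) (F : Finset ε) :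
    (matchingSum (splitPoly t S x j r) l (splitRight S r) F).coeff 0 +
      (matchingSum (splitPoly t S x j r) l (splitRight S r) F).coeff 1 =
      splitSum t (insert j S) x l r F := by
  classical
  set D := F.filter fun f => r f = j with hD
  set F' := F.filter fun f => r f ≠ j with hF'
  have hun : D ∪ F' = F := filter_union_filter_not_eq _ _
  have hdis : Disjoint D F' := disjoint_filter_filter_not _ _ _
  have hD0 : ∀ e ∈ D, (splitPoly t S x j r e).coeff 0 = 0 := fun e he => by
    simp [splitPoly, (mem_filter.1 he).2]
  have hD1 : ∀ e ∈ D, (splitPoly t S x j r e).coeff 1 = t := fun e he => by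
    simp [splitPoly, (mem_filter.1 he).2]
  have hF0 : ∀ e ∈ F', (splitPoly t S x j r e).coeff 0 = splitWeight t (insert j S) x r e :=
    fun e he => by simp [splitPoly, splitWeight, (mem_filter.1 he).2]
  have hsr : ∀ e ∈ F', splitRight (insert j S) r e = splitRight S r e := fun e he => by
    simp [splitRight, (mem_filter.1 he).2]
  have hsub : ∀ G ⊆ F', matchingSum (fun e => (splitPoly t S x j r e).coeff 0) l
      (splitRight S r) G = matchingSum (splitWeight t (insert j S) x r) l
      (splitRight (insert j S) r) G := by
    intro G hG
    rw [matchingSum_congr fun e he => hF0 e (hG he)]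
    exact matchingSum_congr_right fun e he f hf => by rw [hsr e (hG he), hsr f (hG hf)]
  have c0 : (matchingSum (splitPoly t S x j r) l (splitRight S r) F).coeff 0 =
      matchingSum (splitWeight t (insert j S) x r) l (splitRight (insert j S) r) F' := by
    rw [coeff_zero_matchingSum]
    conv_lhs => rw [← hun]
    rw [matchingSum_union_eq_of_zero _ _ _ _ _ hD0 hdis, hsub F' subset_rfl]
  have c1 : (matchingSum (splitPoly t S x j r) l (splitRight S r) F).coeff 1 =
      ∑ e ∈ D, t * matchingSum (splitWeight t (insert j S) x r) l (splitRight (insert j S) r)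
        (F'.filter fun f => l f ≠ l e) := by
    conv_lhs => rw [← hun]
    rw [coeff_one_matchingSum _ _ _ _ _ hdis hD0]
    · exact sum_congr rfl fun e he => by rw [hD1 e he, hsub _ (filter_subset _ _)]
    · intro e he
      simp [splitPoly, (mem_filter.1 he).2]
    · intro e he f _ hfe
      have : r e ∉ S := by rwa [(mem_filter.1 he).2]
      by_cases hf : r f ∈ S <;> simp [splitRight, this, hf, hfe]
  have hiff : ∀ f, splitRight (insert j S) r f = Sum.inl j ↔ r f = j := fun f => by
    by_cases hf : r f ∈ insert j S
    · simp [splitRight, hf]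
    · simp only [splitRight, hf, if_false]
      simp only [reduceCtorEq, false_iff]
      exact fun h => hf (by simp [h])
  rw [c0, c1, splitSum, matchingSum_expand_right _ l (splitRight (insert j S) r) F (Sum.inl j)]
  simp only [ne_eq, hiff]
  congr 1
  refine sum_congr rfl fun e he => ?_
  simp [splitWeight, (mem_filter.1 he).2, hF']

theorem natDegree_matchingSum_splitPoly_le [DecidableEq β] (t : ℝ) (S : Finset β) (x : β → ℝ)
    (j : β) (l : ε → α) (r : ε → β) (F : Finset ε) :
    (matchingSum (splitPoly t S x j r) l (splitRight S r) F).natDegree ≤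
      (F.filter fun f => r f = j).card := by
  classical
  refine natDegree_sum_le_of_forall_le _ _ fun M hM => (natDegree_prod_le _ _).trans ?_
  have h1 : ∀ e ∈ M, (splitPoly t S x j r e).natDegree ≤ if r e = j then 1 else 0 := by
    intro e _
    by_cases h : r e = j
    · simpa [splitPoly, h] using (natDegree_C_mul_le t X).trans natDegree_X_le
    · simp [splitPoly, h]
  refine (sum_le_sum h1).trans ?_
  rw [← card_filter]
  exact card_le_card (filter_subset_filter _ (mem_matchings.1 hM).1)

/-- Heilmann-Lieb with vertex weights built from `s = √z`: weight `s` at left vertices and at the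
leaves of `j`, weight `s⁻¹` at all other right vertices. Edges at `j` then receive `s * s = z` and
all others `s * s⁻¹ = 1`. -/
theorem aeval_matchingSum_splitPoly_ne_zero [DecidableEq β] {t : ℝ} (ht : 0 < t) (S : Finset β)
    {x : β → ℝ} (hx : ∀ b, 0 < x b) {j : β} (hj : j ∉ S) (l : ε → α) (r : ε → β) (F : Finset ε)
    {z : ℂ} (hz : z ∈ Complex.slitPlane) :
    aeval z (matchingSum (splitPoly t S x j r) l (splitRight S r) F) ≠ 0 := by
  classical
  obtain ⟨s, hs, hs0⟩ := exists_sq_eq_of_mem_slitPlane hz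
  have hsne : s ≠ 0 := fun h => by simp [h] at hs0
  have := map_matchingSum (aeval z : ℝ[X] →ₐ[ℝ] ℂ).toRingHom (splitPoly t S x j r) l
    (splitRight S r) F
  have h2 : aeval z (matchingSum (splitPoly t S x j r) l (splitRight S r) F) = _ := this
  rw [h2]
  convert matchingSum_ne_zero (fun e => splitWeight t S (Function.update x j 1) r e) l
    (splitRight S r) (fun _ => s)
    (Sum.elim (fun _ => s⁻¹) fun e => if r e = j then s else s⁻¹) ?_ (fun _ => hs0) ?_ F using 2
  · ext e
    by_cases h : r e = j
    · simp [splitPoly, splitWeight, splitRight, h, hj, hs]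
    · by_cases hS : r e ∈ S <;> simp [splitPoly, splitWeight, splitRight, h, hS, hsne]
  · intro e
    have h1 : 0 < Function.update x j 1 (r e) := by
      by_cases h : r e = j
      · simp [h]
      · simpa [h] using hx _
    simp only [splitWeight]
    split_ifs <;> positivity
  · rintro (b | e)
    · exact re_inv_pos hs0
    · simp only [Sum.elim_inr]
      split_ifs
      · exact hs0
      · exact re_inv_pos hs0

end Splitting

/-! ### Capacity estimates. -/

section Capacity

open Polynomial

/-- The loss of capacity when a right vertex of degree `d` is restored. -/
noncomputable def capacityFactor (d : ℕ) (p : ℝ) : ℝ :=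
  (1 - p / d) ^ ((d : ℝ) - p) * ((1 - p) ^ (1 - p))⁻¹

/-- Weighted AM-GM for `1 + s = (1 - p) * (1 - p)⁻¹ + p * (s / p)`. -/
theorem capacity_two_point {p : ℝ} (hp0 : 0 < p) (hp1 : p < 1) {s : ℝ} (hs : 0 ≤ s) :
    ((1 - p) ^ (1 - p))⁻¹ * (s / p) ^ p ≤ 1 + s := by
  have h := Real.geom_mean_le_arith_mean2_weighted (sub_nonneg.2 hp1.le) hp0.le
    (p₁ := (1 - p)⁻¹) (p₂ := s / p) (inv_nonneg.2 (sub_nonneg.2 hp1.le)) (by positivity)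
    (by ring)
  rw [mul_inv_cancel₀ (sub_pos.2 hp1).ne', mul_div_cancel₀ _ hp0.ne',
    Real.inv_rpow (sub_nonneg.2 hp1.le)] at h
  exact h

/-- AM-GM replaces the product by `(1 + s * u / d) ^ d`, where `s` is the sum of the `c i`. Taking
the best `u` bounds `B` by a multiple of `(s / p) ^ p`, and `capacity_two_point` compares this with
`1 + s`. -/
theorem capacity_step {d : ℕ} (hd : 1 ≤ d) {p : ℝ} (hp0 : 0 < p) (hp1 : p < 1) (c : ℕ → ℝ)
    (hc : ∀ i, 0 ≤ c i) {a : ℝ} (ha : 0 < a) (B : ℝ)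
    (hB : ∀ u > 0, B * u ^ p ≤ a * (∏ i ∈ range d, (1 + C (c i) * X)).eval u) :
    capacityFactor d p * B ≤ a * (1 + ∑ i ∈ range d, c i) := by
  have hd' : (1 : ℝ) ≤ d := by exact_mod_cast hd
  have hd0 : (0 : ℝ) < d := by linarith
  set s := ∑ i ∈ range d, c i with hs
  have hs0 : 0 ≤ s := sum_nonneg fun i _ => hc i
  have hq : 0 < 1 - p / d := by
    rw [sub_pos, div_lt_one hd0]
    linarith
  have hK : 0 < capacityFactor d p := by
    have : 0 < 1 - p := sub_pos.2 hp1
    unfold capacityFactor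
    positivity
  have hB' : ∀ u > 0, B * u ^ p ≤ a * (1 + s * u / d) ^ d := fun u hu =>
    (hB u hu).trans (mul_le_mul_of_nonneg_left
      (eval_prod_linear_le c hc (by omega) hu.le) ha.le)
  rcases hs0.eq_or_lt with h0 | hspos
  · have h1 := hB' (capacityFactor d p ^ p⁻¹) (by positivity)
    rw [← Real.rpow_mul hK.le, inv_mul_cancel₀ hp0.ne', Real.rpow_one, ← h0] at h1
    rw [← h0]
    simp only [zero_mul, zero_div, add_zero, one_pow] at h1
    linarith
  · have hu : 0 < p / (s * (1 - p / d)) := by positivity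
    have h1 := hB' _ hu
    have e1 : 1 + s * (p / (s * (1 - p / d))) / d = (1 - p / d)⁻¹ := by
      have := hq.ne'
      field_simp
      have h2 : (d : ℝ) - p ≠ 0 := by linarith
      field_simp
      ring
    have e2 : (p / (s * (1 - p / d))) ^ p = ((s / p) ^ p)⁻¹ * ((1 - p / d) ^ p)⁻¹ := by
      rw [← Real.inv_rpow (by positivity), ← Real.inv_rpow hq.le,
        ← Real.mul_rpow (by positivity) (by positivity)]
      congr 1
      rw [inv_div]
      have := hq.ne'
      rw [← div_eq_mul_inv, div_div]
    rw [e1, e2] at h1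
    have h2 := capacity_two_point hp0 hp1 hs0
    have e3 : (1 - p / d) ^ ((d : ℝ) - p) = (1 - p / d) ^ d * ((1 - p / d) ^ p)⁻¹ := by
      rw [Real.rpow_sub hq, Real.rpow_natCast, div_eq_mul_inv]
    have hsp : 0 < (s / p) ^ p := by positivity
    have hqd : 0 < (1 - p / d) ^ d := by positivity
    have h3 : (1 - p / d) ^ ((d : ℝ) - p) * B ≤ a * (s / p) ^ p := by
      have h4 := mul_le_mul_of_nonneg_right h1 (mul_pos hsp hqd).le
      rw [e3]
      rw [inv_pow] at h4
      calc _ = B * (((s / p) ^ p)⁻¹ * ((1 - p / d) ^ p)⁻¹) * ((s / p) ^ p * (1 - p / d) ^ d) := by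
            field_simp
        _ ≤ _ := h4
        _ = _ := by
          rw [mul_comm ((s / p) ^ p), ← mul_assoc, mul_assoc a, inv_mul_cancel₀ hqd.ne', mul_one]
    have hp1' : 0 < ((1 - p) ^ (1 - p))⁻¹ := by
      have : 0 < 1 - p := sub_pos.2 hp1
      positivity
    calc capacityFactor d p * B
        = ((1 - p) ^ (1 - p))⁻¹ * ((1 - p / d) ^ ((d : ℝ) - p) * B) := by
          unfold capacityFactor
          ring
      _ ≤ ((1 - p) ^ (1 - p))⁻¹ * (a * (s / p) ^ p) := mul_le_mul_of_nonneg_left h3 hp1'.le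
      _ = a * (((1 - p) ^ (1 - p))⁻¹ * (s / p) ^ p) := by ring
      _ ≤ a * (1 + s) := mul_le_mul_of_nonneg_left h2 ha.le

theorem splitSum_insert_ge [DecidableEq β] {d : ℕ} (hd : 1 ≤ d) {p : ℝ} (hp0 : 0 < p)
    (hp1 : p < 1) {t : ℝ} (ht : 0 < t) (S : Finset β) {j : β} (hj : j ∉ S) {x : β → ℝ}
    (hx : ∀ b, 0 < x b) (l : ε → α) (r : ε → β) (F : Finset ε)
    (hdeg : (F.filter fun e => r e = j).card ≤ d) (B : ℝ)
    (hB : ∀ u > 0, B * u ^ p ≤ splitSum t S (Function.update x j u) l r F) :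
    capacityFactor d p * B ≤ splitSum t (insert j S) x l r F := by
  classical
  set f := matchingSum (splitPoly t S x j r) l (splitRight S r) F with hf
  have hpos : 0 < f.eval 0 := by
    rw [hf, eval_matchingSum_splitPoly t S x hj]
    refine lt_of_lt_of_le one_pos (one_le_matchingSum _ _ _ _ fun e _ => ?_)
    have h1 : 0 ≤ Function.update x j 0 (r e) := by
      by_cases h : r e = j
      · simp [h]
      · simpa [h] using (hx _).le
    simp only [splitWeight]
    split_ifs <;> positivity
  obtain ⟨c, hc, hfc⟩ := exists_eq_prod_linear d f hpos.ne'
    (fun z hz => aeval_matchingSum_splitPoly_ne_zero ht S hx hj l r F hz)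
    ((natDegree_matchingSum_splitPoly_le t S x j l r F).trans hdeg)
  have h1 := capacity_step hd hp0 hp1 c hc hpos B fun u hu => by
    have h2 := hB u hu
    rw [← eval_matchingSum_splitPoly t S x hj, ← hf, hfc] at h2
    simpa using h2
  rw [← coeff_matchingSum_splitPoly t S x hj, ← hf, coeff_zero_eq_eval_zero]
  have h3 : f.coeff 1 = f.eval 0 * ∑ i ∈ range d, c i := by
    conv_lhs => rw [hfc]
    rw [coeff_C_mul, coeff_one_prod_linear]
  rw [h3]
  linarith

/-- Each left vertex contributes a factor `1 + t * ∑ x (r e)`, bounded by `capacity_two_point` and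
then by AM-GM over its `d` edges. Every `x u` thus appears with exponent `p / d` once for each of
the `d` edges at `u`, giving `x u ^ p`. -/
theorem splitSum_empty_ge [DecidableEq α] [DecidableEq β] {d : ℕ} (hd : 1 ≤ d) {p : ℝ}
    (hp0 : 0 < p) (hp1 : p < 1) {t : ℝ} (ht : 0 < t) {x : β → ℝ} (hx : ∀ b, 0 < x b)
    (l : ε → α) (r : ε → β) (F : Finset ε) (L : Finset α) (R : Finset β)
    (hl : ∀ e ∈ F, l e ∈ L) (hr : ∀ e ∈ F, r e ∈ R)
    (hdl : ∀ v ∈ L, (F.filter fun e => l e = v).card = d)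
    (hdr : ∀ u ∈ R, (F.filter fun e => r e = u).card = d) :
    (((1 - p) ^ (1 - p))⁻¹ * (t * d / p) ^ p) ^ L.card * ∏ u ∈ R, x u ^ p ≤
      splitSum t ∅ x l r F := by
  have hd0 : (0 : ℝ) < d := by exact_mod_cast hd
  rw [splitSum, matchingSum_of_injOn_right _ _ _ _ (by simp [Set.InjOn, splitRight]) L hl]
  have hprod : ∏ u ∈ R, x u ^ p = ∏ v ∈ L, ∏ e ∈ F.filter (fun e => l e = v), x (r e) ^ (p / d) := by
    rw [prod_fiberwise_of_maps_to hl, ← prod_fiberwise_of_maps_to hr]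
    refine prod_congr rfl fun u hu => ?_
    rw [prod_congr rfl (g := fun _ => x u ^ (p / d)) fun e he => by rw [(mem_filter.1 he).2],
      prod_const, hdr u hu, ← Real.rpow_natCast, ← Real.rpow_mul (hx u).le,
      div_mul_cancel₀ _ hd0.ne']
  rw [hprod, ← prod_const, ← prod_mul_distrib]
  have hp1' : 0 < ((1 - p) ^ (1 - p))⁻¹ := by
    have : 0 < 1 - p := sub_pos.2 hp1
    positivity
  refine prod_le_prod (fun v _ => mul_nonneg (by positivity)
    (prod_nonneg fun e _ => by have := hx (r e); positivity)) fun v hv => ?_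
  have hsum : ∑ e ∈ F.filter (fun e => l e = v), splitWeight t ∅ x r e =
      t * d * ∑ e ∈ F.filter (fun e => l e = v), (d : ℝ)⁻¹ * x (r e) := by
    rw [mul_sum]
    refine sum_congr rfl fun e _ => ?_
    simp only [splitWeight, notMem_empty, if_false]
    field_simp
  set A := ∑ e ∈ F.filter (fun e => l e = v), (d : ℝ)⁻¹ * x (r e) with hA
  have hgm := Real.geom_mean_le_arith_mean_weighted (F.filter fun e => l e = v)
    (fun _ => (d : ℝ)⁻¹) (fun e => x (r e)) (fun _ _ => by positivity)
    (by rw [sum_const, hdl v hv, nsmul_eq_mul, mul_inv_cancel₀ hd0.ne'])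
    (fun e _ => (hx (r e)).le)
  rw [← hA] at hgm
  have hA0 : 0 ≤ A := sum_nonneg fun e _ => by have := hx (r e); positivity
  rw [hsum]
  refine le_trans ?_ (capacity_two_point hp0 hp1 (by positivity : 0 ≤ t * d * A))
  have e1 : t * d * A / p = t * d / p * A := by ring
  rw [e1, Real.mul_rpow (by positivity) hA0, ← mul_assoc]
  refine mul_le_mul_of_nonneg_left ?_ (by positivity)
  refine le_trans (le_of_eq ?_) (Real.rpow_le_rpow
    (prod_nonneg fun e _ => by have := hx (r e); positivity) hgm hp0.le)
  rw [← Real.finsetProd_rpow _ _ fun e _ => by have := hx (r e); positivity]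
  refine prod_congr rfl fun e _ => ?_
  rw [← Real.rpow_mul (hx _).le]
  congr 1
  ring

theorem splitSum_ge [DecidableEq α] [DecidableEq β] {d : ℕ} (hd : 1 ≤ d) {p : ℝ}
    (hp0 : 0 < p) (hp1 : p < 1) {t : ℝ} (ht : 0 < t) {x : β → ℝ} (hx : ∀ b, 0 < x b)
    (l : ε → α) (r : ε → β) (F : Finset ε) (L : Finset α) (R : Finset β)
    (hl : ∀ e ∈ F, l e ∈ L) (hr : ∀ e ∈ F, r e ∈ R)
    (hdl : ∀ v ∈ L, (F.filter fun e => l e = v).card = d)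
    (hdr : ∀ u ∈ R, (F.filter fun e => r e = u).card = d) (S : Finset β) (hS : S ⊆ R) :
    capacityFactor d p ^ S.card * (((1 - p) ^ (1 - p))⁻¹ * (t * d / p) ^ p) ^ L.card *
      ∏ u ∈ R \ S, x u ^ p ≤ splitSum t S x l r F := by
  -- The variables must stay free: gluing `j` needs the bound for every value of `x j`.
  induction S using Finset.induction_on generalizing x with
  | empty =>
    simpa using splitSum_empty_ge hd hp0 hp1 ht hx l r F L R hl hr hdl hdr
  | insert j S hj ih =>
    have hjR : j ∈ R := hS (mem_insert_self _ _)
    have h1 := splitSum_insert_ge hd hp0 hp1 ht S hj hx l r F (hdr j hjR).le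
      (capacityFactor d p ^ S.card * (((1 - p) ^ (1 - p))⁻¹ * (t * d / p) ^ p) ^ L.card *
      ∏ u ∈ R \ insert j S, x u ^ p) fun u hu => by
        have hx' : ∀ b, 0 < Function.update x j u b := fun b => by
          by_cases h : b = j
          · simpa [h] using hu
          · simpa [h] using hx b
        refine le_trans (le_of_eq ?_) (ih hx' fun b hb => hS (mem_insert_of_mem hb))
        have e1 : R \ S = insert j (R \ insert j S) := by
          ext b
          simp only [mem_sdiff, mem_insert]
          grind
        rw [e1, prod_insert (by simp)]
        have e2 : ∏ b ∈ R \ insert j S, Function.update x j u b ^ p =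
            ∏ b ∈ R \ insert j S, x b ^ p := by
          refine prod_congr rfl fun b hb => ?_
          rw [Function.update_of_ne]
          rintro rfl
          simp at hb
        rw [e2, Function.update_self]
        ring
    refine le_trans (le_of_eq ?_) h1
    rw [card_insert_of_notMem hj]
    ring

/-- The monomer-dimer partition function of a `d`-regular bipartite graph dominates that of the
infinite `d`-regular tree. -/
theorem matchingSum_const_ge {d : ℕ} (hd : 1 ≤ d) {p : ℝ}
    (hp0 : 0 < p) (hp1 : p < 1) {t : ℝ} (ht : 0 < t) [DecidableEq α] [DecidableEq β]
    (l : ε → α) (r : ε → β) (F : Finset ε) (L : Finset α) (R : Finset β)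
    (hl : ∀ e ∈ F, l e ∈ L) (hr : ∀ e ∈ F, r e ∈ R)
    (hdl : ∀ v ∈ L, (F.filter fun e => l e = v).card = d)
    (hdr : ∀ u ∈ R, (F.filter fun e => r e = u).card = d) (hLR : L.card = R.card) :
    Real.exp (2 * (L.card : ℝ) * entropyG d p) * t ^ ((L.card : ℝ) * p) ≤
      matchingSum (fun _ => t) l r F := by
  have hd' : (1 : ℝ) ≤ d := by exact_mod_cast hd
  have hd0 : (0 : ℝ) < d := by linarith
  have hq : 0 < 1 - p / d := by
    rw [sub_pos, div_lt_one hd0]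
    linarith
  have hp1' : 0 < 1 - p := sub_pos.2 hp1
  have h := splitSum_ge hd hp0 hp1 ht (x := fun _ => 1) (fun _ => one_pos) l r F L R hl hr hdl hdr
    R subset_rfl
  have e1 : splitSum t R (fun _ => 1) l r F = matchingSum (fun _ => t) l r F := by
    rw [splitSum, matchingSum_congr (w' := fun _ => t) fun e _ => by simp [splitWeight]]
    exact matchingSum_congr_right fun e he f hf => by simp [splitRight, hr e he, hr f hf]
  rw [e1] at h
  refine le_trans (le_of_eq ?_) h
  simp only [sdiff_self, Real.one_rpow, prod_const_one, mul_one]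
  rw [← hLR, ← mul_pow]
  have e2 : capacityFactor d p * (((1 - p) ^ (1 - p))⁻¹ * (t * d / p) ^ p) =
      Real.exp (2 * entropyG d p) * t ^ p := by
    rw [mul_div_assoc, Real.mul_rpow ht.le (by positivity), capacityFactor,
      Real.rpow_def_of_pos hq, Real.rpow_def_of_pos hp1',
      Real.rpow_def_of_pos (by positivity : 0 < (d : ℝ) / p), ← Real.exp_neg]
    rw [show 2 * entropyG d p = Real.log (1 - p / d) * ((d : ℝ) - p) +
      -(Real.log (1 - p) * (1 - p)) + -(Real.log (1 - p) * (1 - p)) + Real.log (d / p) * p by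
        unfold entropyG
        ring]
    simp only [Real.exp_add]
    ring
  rw [e2, mul_pow, ← Real.exp_nat_mul, ← Real.rpow_natCast, ← Real.rpow_mul ht.le]
  ring_nf

end Capacity

end BipartiteMatching

namespace BipartiteMatching

open Finset

variable {ε α β : Type*}

/-! ### From the partition function to the number of `k`-matchings. -/

section Polynomial

open Polynomial

theorem coeff_matchingSum_X (l : ε → α) (r : ε → β) (F : Finset ε) (k : ℕ) :
    (matchingSum (fun _ => (X : ℝ[X])) l r F).coeff k =
      (((matchings l r F).filter fun M => M.card = k).card : ℝ) := by
  rw [matchingSum, finsetSum_coeff, card_filter, Nat.cast_sum]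
  refine sum_congr rfl fun M _ => ?_
  rw [prod_const, coeff_X_pow, Nat.cast_ite, Nat.cast_one, Nat.cast_zero]
  simp only [eq_comm]

theorem eval_matchingSum_X (l : ε → α) (r : ε → β) (F : Finset ε) (t : ℝ) :
    (matchingSum (fun _ => (X : ℝ[X])) l r F).eval t = matchingSum (fun _ => t) l r F := by
  simpa using map_matchingSum (evalRingHom t) (fun _ => (X : ℝ[X])) l r F

/-- The matching generating polynomial is real-rooted. -/
theorem matchingSum_X_eq_prod (l : ε → α) (r : ε → β) (F : Finset ε) (L : Finset α)
    (hl : ∀ e ∈ F, l e ∈ L) :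
    ∃ c : ℕ → ℝ, (∀ i, 0 ≤ c i) ∧ matchingSum (fun _ => (X : ℝ[X])) l r F =
      ∏ i ∈ range L.card, (1 + C (c i) * X) := by
  classical
  have h0 : (matchingSum (fun _ => (X : ℝ[X])) l r F).eval 0 = 1 := by
    rw [eval_matchingSum_X]
    simpa [matchingSum_empty] using matchingSum_union_eq_of_zero (fun _ => (0 : ℝ)) l r F ∅
      (fun _ _ => rfl) (disjoint_empty_right _)
  obtain ⟨c, hc, h⟩ := exists_eq_prod_linear L.card (matchingSum (fun _ => (X : ℝ[X])) l r F)
    (by rw [h0]; exact one_ne_zero) (fun z hz => by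
      obtain ⟨s, hs, hs0⟩ := exists_sq_eq_of_mem_slitPlane hz
      have h1 : aeval z (matchingSum (fun _ => (X : ℝ[X])) l r F) = _ :=
        map_matchingSum (aeval z : ℝ[X] →ₐ[ℝ] ℂ).toRingHom (fun _ => (X : ℝ[X])) l r F
      rw [h1]
      convert matchingSum_ne_zero (fun _ => 1) l r (fun _ => s) (fun _ => s)
        (fun _ => zero_le_one) (fun _ => hs0) (fun _ => hs0) F using 2
      ext e
      simp [hs]) (by
      refine natDegree_sum_le_of_forall_le _ _ fun M hM => ?_
      rw [prod_const, natDegree_X_pow]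
      obtain ⟨hM1, hM2, _⟩ := mem_matchings.1 hM
      exact card_le_card_of_injOn l (fun e he => hl e (hM1 he)) hM2)
  exact ⟨c, hc, by simpa [h0] using h⟩

end Polynomial

/-- The capacity bound is proved for `p < 1` only. For `d = 1` the argument `1 - p / d` also
vanishes at `p = 1`, so continuity is read off from `x * log x`. -/
theorem tendsto_entropyG_one {d : ℕ} (hd : 1 ≤ d) :
    Filter.Tendsto (entropyG d) (nhdsWithin 1 (Set.Iio 1)) (nhds (entropyG d 1)) := by
  have hd0 : (d : ℝ) ≠ 0 := by exact_mod_cast (by omega : d ≠ 0)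
  have h : entropyG d = fun p => (1 / 2) * (p * Real.log (d / p) +
      d * ((1 - p / d) * Real.log (1 - p / d)) - 2 * ((1 - p) * Real.log (1 - p))) := by
    ext p
    unfold entropyG
    have : (d : ℝ) - p = d * (1 - p / d) := by field_simp
    rw [this]
    ring
  have hc : ContinuousAt (entropyG d) 1 := by
    rw [h]
    have h1 : ContinuousAt (fun p : ℝ => p * Real.log (d / p)) 1 :=
      continuousAt_id.mul ((continuousAt_const.div continuousAt_id one_ne_zero).log (by simpa using hd0))
    have h2 : Continuous fun p : ℝ => (1 - p / d) * Real.log (1 - p / d) :=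
      Real.continuous_mul_log.comp (by fun_prop : Continuous fun p : ℝ => 1 - p / d)
    have h3 : Continuous fun p : ℝ => (1 - p) * Real.log (1 - p) :=
      Real.continuous_mul_log.comp (by fun_prop : Continuous fun p : ℝ => 1 - p)
    exact continuousAt_const.mul ((h1.add (continuousAt_const.mul h2.continuousAt)).sub
      (continuousAt_const.mul h3.continuousAt))
  exact hc.tendsto.mono_left nhdsWithin_le_nhds

/-- The lower bound on the number of matchings of size `k` of a regular bipartite graph. -/
theorem card_matchings_ge [DecidableEq α] [DecidableEq β] {d n : ℕ} (hd : 1 ≤ d) (hn : 1 ≤ n)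
    (l : ε → α) (r : ε → β) (F : Finset ε) (L : Finset α) (R : Finset β)
    (hl : ∀ e ∈ F, l e ∈ L) (hr : ∀ e ∈ F, r e ∈ R)
    (hdl : ∀ v ∈ L, (F.filter fun e => l e = v).card = d)
    (hdr : ∀ u ∈ R, (F.filter fun e => r e = u).card = d) (hL : L.card = n) (hR : R.card = n)
    {k : ℕ} (hk : k ≤ n) :
    binomialMeanProb n k * Real.exp (2 * (n : ℝ) * entropyG d ((k : ℝ) / n)) ≤
      (((matchings l r F).filter fun M => M.card = k).card : ℝ) := by
  have hn0 : (0 : ℝ) < n := by exact_mod_cast hn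
  rcases Nat.eq_zero_or_pos k with rfl | hk0
  · have h1 : binomialMeanProb n 0 = 1 := by simp [binomialMeanProb]
    have h2 : entropyG d (((0 : ℕ) : ℝ) / n) = 0 := by simp [entropyG]
    rw [h1, h2, mul_zero, Real.exp_zero, one_mul]
    exact_mod_cast card_pos.2 ⟨∅, by simp [mem_matchings]⟩
  obtain ⟨c, hc, hprod⟩ := matchingSum_X_eq_prod l r F L hl
  rw [hL] at hprod
  have heval : ∀ t, matchingSum (fun _ => t) l r F = ∏ i ∈ range n, (1 + c i * t) := fun t => by
    rw [← eval_matchingSum_X, hprod]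
    simp [Polynomial.eval_prod]
  have hcap : ∀ p : ℝ, 0 < p → p < 1 → ∀ t > 0,
      Real.exp (2 * (n : ℝ) * entropyG d p) * t ^ ((n : ℝ) * p) ≤
        ∏ i ∈ range n, (1 + c i * t) := by
    intro p hp0 hp1 t ht
    rw [← heval]
    have := matchingSum_const_ge hd hp0 hp1 ht l r F L R hl hr hdl hdr (hL.trans hR.symm)
    rwa [hL] at this
  have hcap1 : ∀ t > 0, Real.exp (2 * (n : ℝ) * entropyG d 1) * t ^ n ≤
        ∏ i ∈ range n, (1 + c i * t) := by
    intro t ht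
    have hlim : Filter.Tendsto (fun p => Real.exp (2 * (n : ℝ) * entropyG d p) * t ^ ((n : ℝ) * p))
        (nhdsWithin 1 (Set.Iio 1))
        (nhds (Real.exp (2 * (n : ℝ) * entropyG d 1) * t ^ ((n : ℝ) * 1))) := by
      refine Filter.Tendsto.mul ?_ ?_
      · exact (Real.continuous_exp.tendsto _).comp ((tendsto_entropyG_one hd).const_mul _)
      · have : Continuous fun p : ℝ => t ^ ((n : ℝ) * p) :=
          Continuous.rpow continuous_const (by fun_prop) fun _ => Or.inl ht.ne'
        exact (this.tendsto 1).mono_left nhdsWithin_le_nhds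
    rw [mul_one, Real.rpow_natCast] at hlim
    refine le_of_tendsto hlim ?_
    filter_upwards [Ioo_mem_nhdsLT (zero_lt_one' ℝ)] with p hp
    exact hcap p hp.1 hp.2 t ht
  -- The bound at `p = 1` makes the top coefficient positive. Hence no `c i` vanishes, as the
  -- log-concavity argument requires, and the case `k = n` follows.
  have htop := prod_ge_of_capacity c n _ hcap1
  have hcpos : ∀ i < n, 0 < c i := fun i hi => (hc i).lt_of_ne fun h0 => by
    rw [prod_eq_zero (mem_range.2 hi) h0.symm] at htop
    exact absurd htop (not_le.2 (Real.exp_pos _))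
  rw [← coeff_matchingSum_X, hprod, coeff_prod_linear]
  rcases hk.eq_or_lt with rfl | hkn
  · rw [normCoeff_self, div_self hn0.ne']
    have h1 : binomialMeanProb k k = 1 := by simp [binomialMeanProb, hn0.ne']
    rw [h1, Nat.choose_self, Nat.cast_one, one_mul, one_mul]
    exact htop
  · have hk0' : (0 : ℝ) < k := by exact_mod_cast hk0
    have h1 := normCoeff_ge_of_capacity c n k hcpos hk0 hkn
      (Real.exp (2 * (n : ℝ) * entropyG d ((k : ℝ) / n))) fun t ht => by
        have := hcap ((k : ℝ) / n) (by positivity)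
          (by rw [div_lt_one hn0]; exact_mod_cast hkn) t ht
        rwa [mul_div_cancel₀ _ hn0.ne', Real.rpow_natCast] at this
    rw [binomialMeanProb]
    calc _ = (n.choose k : ℝ) * (Real.exp (2 * (n : ℝ) * entropyG d ((k : ℝ) / n)) *
          (((k : ℝ) / n) ^ k * (1 - (k : ℝ) / n) ^ (n - k))) := by ring
      _ ≤ _ := mul_le_mul_of_nonneg_left h1 (Nat.cast_nonneg _)

theorem binomialMeanProb_nonneg {n k : ℕ} (hk : k ≤ n) : 0 ≤ binomialMeanProb n k := by
  have : 0 ≤ 1 - (k : ℝ) / n := sub_nonneg.2 (div_le_one_of_le₀ (by exact_mod_cast hk) (by simp))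
  unfold binomialMeanProb
  positivity

theorem binomialMeanProb_le_one {n k : ℕ} (hk : k ≤ n) : binomialMeanProb n k ≤ 1 := by
  set p : ℝ := (k : ℝ) / n with hp
  have h1 : 0 ≤ 1 - p := sub_nonneg.2 (div_le_one_of_le₀ (by exact_mod_cast hk) (by simp))
  have h2 : 0 ≤ p := by positivity
  have h3 := add_pow p (1 - p) n
  rw [add_sub_cancel, one_pow] at h3
  rw [h3, binomialMeanProb, ← hp]
  have := single_le_sum (f := fun i => p ^ i * (1 - p) ^ (n - i) * (n.choose i : ℝ))
    (fun i _ => by positivity) (mem_range.2 (Nat.lt_succ_of_le hk))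
  refine le_trans (le_of_eq ?_) this
  ring

/-- The powers of `p` and `1 - p` are kept on the left, not divided out, so that the identity
survives at `k = 0` and `k = n`. -/
theorem exp_two_mul_entropyG {d n : ℕ} (hd : 1 ≤ d) (hn : 1 ≤ n) {k : ℕ} (hk : k ≤ n) :
    Real.exp (2 * (n : ℝ) * entropyG d ((k : ℝ) / n)) *
        (((k : ℝ) / n) ^ k * (1 - (k : ℝ) / n) ^ (2 * (n - k))) =
      (d : ℝ) ^ k * (1 - (k : ℝ) / n / d) ^ ((n : ℝ) * ((d : ℝ) - (k : ℝ) / n)) := by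
  have hn0 : (0 : ℝ) < n := by exact_mod_cast hn
  have hd0 : (0 : ℝ) < d := by exact_mod_cast hd
  set p : ℝ := (k : ℝ) / n with hp
  have hnp : (n : ℝ) * p = k := mul_div_cancel₀ _ hn0.ne'
  have hnk : ((n - k : ℕ) : ℝ) = n * (1 - p) := by
    rw [Nat.cast_sub hk, mul_sub, hnp, mul_one]
  have hp1 : 0 ≤ 1 - p := sub_nonneg.2 (div_le_one_of_le₀ (by exact_mod_cast hk) (by simp))
  have hp0 : 0 ≤ p := by positivity
  -- At `x = 0` the exponent must vanish too; then `0 * log 0 = 0` agrees with `0 ^ 0 = 1`.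
  have key : ∀ x : ℝ, 0 ≤ x → ∀ a : ℝ, (x = 0 → a = 0) → Real.exp (a * Real.log x) = x ^ a := by
    intro x hx a ha
    rcases hx.eq_or_lt with h | h
    · rw [← h, ha h.symm]
      simp
    · rw [Real.rpow_def_of_pos h, mul_comm]
  have hq : 0 ≤ 1 - p / d := by
    rw [sub_nonneg, div_le_one hd0]
    have : (1 : ℝ) ≤ d := by exact_mod_cast hd
    linarith
  have e1 : Real.exp (k * Real.log (d / p)) * p ^ k = (d : ℝ) ^ k := by
    rw [key _ (by positivity) _ fun h => ?_, Real.rpow_natCast, ← mul_pow]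
    · rcases hp0.eq_or_lt with h | h
      · have : (k : ℝ) = 0 := by rw [← hnp, ← h, mul_zero]
        have : k = 0 := by exact_mod_cast this
        simp [this]
      · rw [div_mul_cancel₀ _ h.ne']
    · rcases div_eq_zero_iff.1 h with h | h
      · exact absurd h hd0.ne'
      · rw [← hnp, h, mul_zero]
  have e2 : Real.exp ((n : ℝ) * (d - p) * Real.log (1 - p / d)) =
      (1 - p / d) ^ ((n : ℝ) * ((d : ℝ) - p)) := by
    refine key _ hq _ fun h => ?_
    have : (d : ℝ) - p = d * (1 - p / d) := by field_simp
    rw [this, h]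
    ring
  have e3 : Real.exp (((2 * (n - k) : ℕ) : ℝ) * Real.log (1 - p)) = (1 - p) ^ (2 * (n - k)) := by
    rw [key _ hp1 _ fun h => ?_, Real.rpow_natCast]
    push_cast
    rw [hnk, h]
    ring
  have e4 : 2 * (n : ℝ) * entropyG d p = k * Real.log (d / p) +
      (n : ℝ) * (d - p) * Real.log (1 - p / d) +
      -(((2 * (n - k) : ℕ) : ℝ) * Real.log (1 - p)) := by
    push_cast
    rw [hnk, ← hnp]
    unfold entropyG
    ring
  rw [e4, Real.exp_add, Real.exp_add, Real.exp_neg, ← e2, ← e3, ← e1]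
  have := (Real.exp_pos (((2 * (n - k) : ℕ) : ℝ) * Real.log (1 - p))).ne'
  field_simp

/-- Friedland's bound is at most the bound with the binomial probability. -/
theorem friedland_le {d n : ℕ} (hd : 1 ≤ d) (hn : 1 ≤ n) {k : ℕ} (hk : k ≤ n) {p : ℝ}
    (hp : p = (k : ℝ) / n) :
    (n.choose k : ℝ) ^ 2 * (((d : ℝ) - p) / d) ^ ((n : ℝ) * ((d : ℝ) - p)) *
        ((d : ℝ) * p) ^ ((n : ℝ) * p) ≤
      binomialMeanProb n k * Real.exp (2 * (n : ℝ) * entropyG d p) := by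
  have hn0 : (0 : ℝ) < n := by exact_mod_cast hn
  have hd0 : (0 : ℝ) < d := by exact_mod_cast hd
  have hnp : (n : ℝ) * p = k := by rw [hp, mul_div_cancel₀ _ hn0.ne']
  have h1 := exp_two_mul_entropyG hd hn hk
  rw [← hp] at h1
  have e1 : ((d : ℝ) - p) / d = 1 - p / d := by field_simp
  rw [e1, hnp, Real.rpow_natCast, mul_pow]
  have h2 : (n.choose k : ℝ) ^ 2 * (1 - p / d) ^ ((n : ℝ) * ((d : ℝ) - p)) *
      ((d : ℝ) ^ k * p ^ k) = binomialMeanProb n k *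
      (binomialMeanProb n k * Real.exp (2 * (n : ℝ) * entropyG d p)) := by
    calc _ = (n.choose k : ℝ) ^ 2 * p ^ k *
          ((d : ℝ) ^ k * (1 - p / d) ^ ((n : ℝ) * ((d : ℝ) - p))) := by ring
      _ = _ := by
        rw [← h1, binomialMeanProb, ← hp]
        ring
  rw [h2]
  exact mul_le_of_le_one_left (mul_nonneg (binomialMeanProb_nonneg hk) (Real.exp_pos _).le)
    (binomialMeanProb_le_one hk)

end BipartiteMatching

namespace BipartiteMatching

open Finset

variable {ε α β V : Type*}

/-! ### Translation between graphs and end maps. -/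

section Graph

/-- The colouring forbids a left end from equalling a right end, so edges meet only on the same
side. -/
theorem numMatchings_eq (G : Graph V ε) (c : V → Bool) (l r : ε → V) (F : Finset ε)
    (hF : (F : Set ε) = G.edgeSet) (hlink : ∀ e ∈ F, G.IsLink e (l e) (r e))
    (hl : ∀ e ∈ F, c (l e) = true) (hr : ∀ e ∈ F, c (r e) = false) (k : ℕ) :
    G.numMatchings k = ((matchings l r F).filter fun M => M.card = k).card := by
  rw [Graph.numMatchings, ← Set.ncard_coe_finset]
  congr 1
  ext M
  simp only [Set.mem_ofPred_eq, coe_filter, mem_matchings, Graph.IsMatchingOfSize, ← hF,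
    coe_subset]
  constructor
  · rintro ⟨hM, hk, h⟩
    refine ⟨⟨hM, fun e he f hf hef => ?_, fun e he f hf hef => ?_⟩, hk⟩
    · by_contra hne
      exact h e he f hf hne (l e) ⟨(hlink e (hM he)).inc_left, hef ▸ (hlink f (hM hf)).inc_left⟩
    · by_contra hne
      exact h e he f hf hne (r e) ⟨(hlink e (hM he)).inc_right, hef ▸ (hlink f (hM hf)).inc_right⟩
  · rintro ⟨⟨hM, hil, hir⟩, hk⟩
    refine ⟨hM, hk, fun e he f hf hne x hx => ?_⟩
    have h1 := hx.1.eq_or_eq_of_isLink (hlink e (hM he))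
    have h2 := hx.2.eq_or_eq_of_isLink (hlink f (hM hf))
    have cle := hl e (hM he)
    have cre := hr e (hM he)
    have clf := hl f (hM hf)
    have crf := hr f (hM hf)
    rcases h1 with rfl | rfl <;> rcases h2 with h2 | h2
    · exact hne (hil he hf h2)
    · rw [h2, crf] at cle
      simp at cle
    · rw [h2, clf] at cre
      simp at cre
    · exact hne (hir he hf h2)

/-- A regular bipartite graph on `2 * n` vertices, described by the two ends of each edge. -/
theorem exists_ends {d n : ℕ} (hd : 1 ≤ d) (hn : 1 ≤ n) (G : Graph V ε) (hb : G.IsBipartite)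
    (hreg : G.IsRegular d) (hV : G.vertexSet.encard = ((2 * n : ℕ) : ℕ∞)) [DecidableEq V] :
    ∃ (l r : ε → V) (F : Finset ε) (L R : Finset V),
      (∀ e ∈ F, l e ∈ L) ∧ (∀ e ∈ F, r e ∈ R) ∧
      (∀ v ∈ L, (F.filter fun e => l e = v).card = d) ∧
      (∀ u ∈ R, (F.filter fun e => r e = u).card = d) ∧ L.card = n ∧ R.card = n ∧
      ∀ k, G.numMatchings k = ((matchings l r F).filter fun M => M.card = k).card := by
  classical
  obtain ⟨c, hc⟩ := hb
  have hVfin : G.vertexSet.Finite := Set.finite_of_encard_eq_coe hV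
  have hinc : ∀ x ∈ G.vertexSet, (G.incidenceSet x).encard = d := fun x hx => by
    have h1 : G.loopSet x = ∅ := by
      ext e
      simp only [Graph.mem_loopSet, Set.mem_empty_iff_false, iff_false]
      exact fun h => hc e x x h rfl
    simpa [Graph.degree, h1] using hreg x hx
  -- Finitely many vertices of finite degree leave only finitely many edges.
  have hEfin : G.edgeSet.Finite := by
    refine (hVfin.biUnion (t := fun x => G.incidenceSet x) fun x hx =>
      Set.finite_of_encard_eq_coe (hinc x hx)).subset fun e he => ?_
    obtain ⟨x, y, h⟩ := G.exists_isLink_of_mem_edgeSet he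
    exact Set.mem_biUnion h.left_mem h.inc_left
  obtain ⟨x0, -⟩ : G.vertexSet.Nonempty := by
    rw [← Set.encard_pos, hV]
    exact_mod_cast (by omega : 0 < 2 * n)
  have hends : ∀ e, ∃ x y, e ∈ G.edgeSet → G.IsLink e x y ∧ c x = true ∧ c y = false := by
    intro e
    by_cases he : e ∈ G.edgeSet
    · obtain ⟨x, y, h⟩ := G.exists_isLink_of_mem_edgeSet he
      have h1 := hc e x y h
      rcases hx : c x
      · rw [hx] at h1
        exact ⟨y, x, fun _ => ⟨h.symm, by simpa using h1.symm, hx⟩⟩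
      · rw [hx] at h1
        exact ⟨x, y, fun _ => ⟨h, hx, by simpa using h1.symm⟩⟩
    · exact ⟨x0, x0, fun h => absurd h he⟩
  choose l r hlr using hends
  set F := hEfin.toFinset with hF
  have hFm : ∀ e, e ∈ F ↔ e ∈ G.edgeSet := fun e => by simp [hF]
  set L := hVfin.toFinset.filter fun x => c x = true with hL
  set R := hVfin.toFinset.filter fun x => ¬ c x = true with hR
  have hl : ∀ e ∈ F, l e ∈ L := fun e he => by
    have := hlr e ((hFm e).1 he)
    simp [hL, this.1.left_mem, this.2.1]
  have hr : ∀ e ∈ F, r e ∈ R := fun e he => by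
    have := hlr e ((hFm e).1 he)
    simp [hR, this.1.right_mem, this.2.2]
  have hdl : ∀ v ∈ L, (F.filter fun e => l e = v).card = d := by
    intro v hv
    have h1 : ((F.filter fun e => l e = v : Finset ε) : Set ε) = G.incidenceSet v := by
      ext e
      simp only [coe_filter, Set.mem_ofPred_eq, hFm, Graph.mem_incidenceSet]
      constructor
      · rintro ⟨he, rfl⟩
        exact (hlr e he).1.inc_left
      · intro h
        have he := h.edge_mem
        refine ⟨he, ?_⟩
        rcases h.eq_or_eq_of_isLink (hlr e he).1 with h' | h'
        · exact h'.symm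
        · have h2 := (mem_filter.1 hv).2
          rw [h', (hlr e he).2.2] at h2
          simp at h2
    have h2 := hinc v (hVfin.mem_toFinset.1 (mem_filter.1 hv).1)
    rw [← h1, Set.encard_coe_eq_coe_finsetCard] at h2
    exact_mod_cast h2
  have hdr : ∀ v ∈ R, (F.filter fun e => r e = v).card = d := by
    intro v hv
    have h1 : ((F.filter fun e => r e = v : Finset ε) : Set ε) = G.incidenceSet v := by
      ext e
      simp only [coe_filter, Set.mem_ofPred_eq, hFm, Graph.mem_incidenceSet]
      constructor
      · rintro ⟨he, rfl⟩
        exact (hlr e he).1.inc_right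
      · intro h
        have he := h.edge_mem
        refine ⟨he, ?_⟩
        rcases h.eq_or_eq_of_isLink (hlr e he).1 with h' | h'
        · have h2 := (mem_filter.1 hv).2
          rw [h', (hlr e he).2.1] at h2
          simp at h2
        · exact h'.symm
    have h2 := hinc v (hVfin.mem_toFinset.1 (mem_filter.1 hv).1)
    rw [← h1, Set.encard_coe_eq_coe_finsetCard] at h2
    exact_mod_cast h2
  -- Counting edges from both sides shows that the colour classes have equal size.
  have hFL : F.card = L.card * d := by
    rw [card_eq_sum_card_fiberwise hl, sum_congr rfl hdl, sum_const, smul_eq_mul]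
  have hFR : F.card = R.card * d := by
    rw [card_eq_sum_card_fiberwise hr, sum_congr rfl hdr, sum_const, smul_eq_mul]
  have hLR : L.card = R.card := Nat.eq_of_mul_eq_mul_right hd (hFL.symm.trans hFR)
  have hsum : L.card + R.card = 2 * n := by
    rw [hL, hR, card_filter_add_card_filter_not]
    have := hV
    rw [hVfin.encard_eq_coe_toFinset_card] at this
    exact_mod_cast this
  refine ⟨l, r, F, L, R, hl, hr, hdl, hdr, by omega, by omega, fun k => ?_⟩
  exact numMatchings_eq G c l r F (by simp [hF]) (fun e he => (hlr e ((hFm e).1 he)).1)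
    (fun e he => (hlr e ((hFm e).1 he)).2.1) (fun e he => (hlr e ((hFm e).1 he)).2.2) k

/-- The multigraph in which the edge `e` joins `l e` to `r e`. -/
def graphOfEnds (l r : ε → V) : Graph V ε where
  vertexSet := Set.univ
  IsLink e x y := (x = l e ∧ y = r e) ∨ (x = r e ∧ y = l e)
  isLink_symm := fun e _ => ⟨fun x y h => h.symm.imp And.symm And.symm⟩
  eq_or_eq_of_isLink_of_isLink := by
    rintro e x y v w (⟨rfl, rfl⟩ | ⟨rfl, rfl⟩) (⟨rfl, rfl⟩ | ⟨rfl, rfl⟩) <;> simp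
  left_mem_of_isLink := fun _ _ _ _ => Set.mem_univ _

theorem graphOfEnds_isLink (l r : ε → V) (e : ε) : (graphOfEnds l r).IsLink e (l e) (r e) :=
  Or.inl ⟨rfl, rfl⟩

theorem graphOfEnds_edgeSet (l r : ε → V) : (graphOfEnds l r).edgeSet = Set.univ :=
  Set.eq_univ_of_forall fun e => (graphOfEnds_isLink l r e).edge_mem

theorem graphOfEnds_inc (l r : ε → V) (e : ε) (x : V) :
    (graphOfEnds l r).Inc e x ↔ l e = x ∨ r e = x := by
  constructor
  · rintro ⟨y, ⟨h, -⟩ | ⟨h, -⟩⟩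
    · exact Or.inl h.symm
    · exact Or.inr h.symm
  · rintro (rfl | rfl)
    · exact (graphOfEnds_isLink l r e).inc_left
    · exact (graphOfEnds_isLink l r e).inc_right

theorem graphOfEnds_isBipartite (c : V → Bool) (l r : ε → V) (hl : ∀ e, c (l e) = true)
    (hr : ∀ e, c (r e) = false) : (graphOfEnds l r).IsBipartite := by
  refine ⟨c, ?_⟩
  rintro e x y (⟨rfl, rfl⟩ | ⟨rfl, rfl⟩) <;> simp [hl, hr]

theorem graphOfEnds_isRegular [Fintype ε] [DecidableEq V] (c : V → Bool) (l r : ε → V)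
    (hl : ∀ e, c (l e) = true) (hr : ∀ e, c (r e) = false) (d : ℕ)
    (hd : ∀ x, (univ.filter fun e => l e = x ∨ r e = x).card = d) :
    (graphOfEnds l r).IsRegular d := by
  intro x _
  have h1 : (graphOfEnds l r).loopSet x = ∅ := by
    ext e
    simp only [Graph.mem_loopSet, Set.mem_empty_iff_false, iff_false]
    rintro (⟨rfl, h⟩ | ⟨rfl, h⟩)
    · have := hl e
      rw [h, hr] at this
      simp at this
    · have := hr e
      rw [h, hl] at this
      simp at this
  have h2 : (graphOfEnds l r).incidenceSet x =
      ((univ.filter fun e => l e = x ∨ r e = x : Finset ε) : Set ε) := by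
    ext e
    simp [Graph.mem_incidenceSet, graphOfEnds_inc]
  rw [Graph.degree, h1, h2, Set.encard_coe_eq_coe_finsetCard, hd]
  simp

end Graph

end BipartiteMatching

namespace BipartiteMatching

open Finset

/-! ### Averaging over random pairings of half-edges. -/

section Counting

variable {ε α β : Type*}

open Polynomial in
/-- The number of partial transversals of size `k`, for `n` classes of size `d`. -/
theorem card_transversals [Fintype ε] [DecidableEq α] {n d : ℕ} (b : ε → α) (L : Finset α)
    (hb : ∀ e, b e ∈ L) (hL : L.card = n) (hd : ∀ v ∈ L, (univ.filter fun e => b e = v).card = d)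
    (k : ℕ) :
    ((matchings b id univ).filter fun M => M.card = k).card = n.choose k * d ^ k := by
  -- The right map `id` imposes no condition, so the generating polynomial is `(1 + d * X) ^ n`.
  have h1 := coeff_matchingSum_X b id univ k
  rw [matchingSum_of_injOn_right _ b id univ Function.injective_id.injOn L fun e _ => hb e] at h1
  have h2 : ∏ v ∈ L, (1 + ∑ e ∈ univ.filter (fun e => b e = v), (X : ℝ[X])) =
      ((1 + X) ^ n).comp (C (d : ℝ) * X) := by
    rw [prod_congr rfl fun v hv => by rw [sum_const, hd v hv], prod_const, hL]
    simp
  rw [h2, comp_C_mul_X_coeff, coeff_one_add_X_pow] at h1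
  exact_mod_cast h1.symm

theorem exists_perm_map_eq [Fintype ε] [DecidableEq ε] {s t : Finset ε} (h : s.card = t.card) :
    ∃ σ : Equiv.Perm ε, s.map σ.toEmbedding = t := by
  refine ⟨(Finset.equivOfCardEq h).extendSubtype, eq_of_subset_of_card_le ?_ (by simp [h])⟩
  intro x hx
  obtain ⟨y, hy, rfl⟩ := mem_map.1 hx
  exact (Finset.equivOfCardEq h).extendSubtype_mem y hy

/-- The number of permutations mapping a `k`-set into a family of `k`-sets. -/
theorem card_perm_map_mem [Fintype ε] [DecidableEq ε] {k : ℕ} {M : Finset ε} (hM : M.card = k)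
    (T : Finset (Finset ε)) (hT : ∀ A ∈ T, A.card = k) :
    (univ.filter fun π : Equiv.Perm ε => M.map π.toEmbedding ∈ T).card *
      (Fintype.card ε).choose k = T.card * (Fintype.card ε).factorial := by
  -- Permutations act transitively on `k`-sets, so all images of `M` are equally frequent. The
  -- common frequency is found below by taking all `k`-sets as the family.
  have hconst : ∀ A : Finset ε, A.card = k →
      (univ.filter fun π : Equiv.Perm ε => M.map π.toEmbedding = A).card =
      (univ.filter fun π : Equiv.Perm ε => M.map π.toEmbedding = M).card := by
    intro A hA
    obtain ⟨σ, hσ⟩ := exists_perm_map_eq (hM.trans hA.symm)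
    symm
    refine card_equiv (Equiv.mulLeft σ) fun π => ?_
    simp only [mem_filter, mem_univ, true_and, Equiv.coe_mulLeft]
    have h1 : M.map (σ * π).toEmbedding = (M.map π.toEmbedding).map σ.toEmbedding := by
      rw [map_map]
      rfl
    rw [h1, ← hσ, map_inj]
  have hfib : ∀ T : Finset (Finset ε), (∀ A ∈ T, A.card = k) →
      (univ.filter fun π : Equiv.Perm ε => M.map π.toEmbedding ∈ T).card = T.card *
      (univ.filter fun π : Equiv.Perm ε => M.map π.toEmbedding = M).card := by
    intro T hT
    have hmaps : ∀ π ∈ univ.filter fun π : Equiv.Perm ε => M.map π.toEmbedding ∈ T,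
        M.map π.toEmbedding ∈ T := fun π hπ => (mem_filter.1 hπ).2
    rw [card_eq_sum_card_fiberwise hmaps, ← smul_eq_mul, ← sum_const]
    refine sum_congr rfl fun A hA => ?_
    rw [← hconst A (hT A hA), filter_filter]
    congr 1
    refine filter_congr fun π _ => and_iff_right_of_imp fun h => h ▸ hA
  have hall := hfib (powersetCard k univ) fun A hA => (mem_powersetCard.1 hA).2
  rw [filter_true_of_mem fun π _ => mem_powersetCard.2 ⟨subset_univ _, by simpa using hM⟩,
    card_powersetCard, card_univ, card_univ, Fintype.card_perm] at hall
  rw [hfib T hT, hall]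
  ring

/-- Some perfect pairing of half-edges produces at most the average number of matchings. -/
theorem exists_perm_card_matchings_le [Fintype ε] [DecidableEq α] {n d : ℕ} (b : ε → α)
    (L : Finset α) (hb : ∀ e, b e ∈ L) (hL : L.card = n)
    (hd : ∀ v ∈ L, (univ.filter fun e => b e = v).card = d) (k : ℕ) :
    ∃ π : Equiv.Perm ε, ((matchings b (b ∘ π) univ).filter fun M => M.card = k).card *
      (Fintype.card ε).choose k ≤ (n.choose k * d ^ k) ^ 2 := by
  classical
  set T := (matchings b id (univ : Finset ε)).filter fun M => M.card = k with hT
  have hTc : T.card = n.choose k * d ^ k := card_transversals b L hb hL hd k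
  have hTm : ∀ M, M ∈ T ↔ Set.InjOn b M ∧ M.card = k := fun M => by
    simp [hT, mem_matchings, Function.injective_id.injOn]
  have hm : ∀ π : Equiv.Perm ε, (matchings b (b ∘ π) univ).filter (fun M => M.card = k) =
      T.filter fun M => M.map π.toEmbedding ∈ T := by
    intro π
    ext M
    simp only [mem_filter, hTm, mem_matchings, subset_univ, true_and, card_map, coe_map,
      Equiv.coe_toEmbedding]
    have : Set.InjOn b (π '' (M : Set ε)) ↔ Set.InjOn (b ∘ π) (M : Set ε) := by
      simp only [Set.InjOn, Set.forall_mem_image, Function.comp_apply, EmbeddingLike.apply_eq_iff_eq]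
    rw [this]
    tauto
  -- Double count of pairs `(M, π)` for which `M` and its image are both partial transversals.
  have hsum : (∑ π : Equiv.Perm ε, ((matchings b (b ∘ π) univ).filter
      fun M => M.card = k).card) * (Fintype.card ε).choose k =
      T.card ^ 2 * (Fintype.card ε).factorial := by
    simp only [hm, card_filter]
    rw [sum_comm]
    simp only [← card_filter]
    rw [sum_mul, sum_congr rfl fun M hM => card_perm_map_mem ((hTm M).1 hM).2 T
      fun A hA => ((hTm A).1 hA).2, sum_const, smul_eq_mul]
    ring
  by_contra! hcon
  have h1 : ∑ π : Equiv.Perm ε, (n.choose k * d ^ k) ^ 2 <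
      ∑ π : Equiv.Perm ε, ((matchings b (b ∘ π) univ).filter fun M => M.card = k).card *
        (Fintype.card ε).choose k :=
    sum_lt_sum_of_nonempty univ_nonempty fun π _ => hcon π
  rw [← sum_mul, hsum, sum_const, card_univ, Fintype.card_perm, smul_eq_mul, hTc, mul_comm] at h1
  exact lt_irrefl _ h1

end Counting

/-! ### Comparison of binomial coefficients through Stirling's sequence. -/

section Stirling

open Stirling

theorem stirlingSeq_pos {m : ℕ} (hm : 0 < m) : 0 < stirlingSeq m := by
  obtain ⟨m, rfl⟩ := Nat.exists_eq_succ_of_ne_zero hm.ne'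
  exact stirlingSeq'_pos m

/-- The decrement is a series of positive terms, each decreasing in `m`. -/
theorem log_stirlingSeq_sub_antitone :
    Antitone fun m : ℕ => Real.log (stirlingSeq (m + 1)) - Real.log (stirlingSeq (m + 2)) := by
  intro m m' h
  refine hasSum_le (fun k => ?_) (log_stirlingSeq_sdiff_hasSum m') (log_stirlingSeq_sdiff_hasSum m)
  gcongr

/-- Ratios of consecutive terms increase with the index, and the two quotients are products of `k`
such ratios. -/
theorem stirlingSeq_div_le {a b k : ℕ} (ha : 0 < a) (hab : a ≤ b) :
    stirlingSeq (a + k) / stirlingSeq a ≤ stirlingSeq (b + k) / stirlingSeq b := by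
  induction k with
  | zero =>
    rw [add_zero, add_zero, div_self (stirlingSeq_pos ha).ne',
      div_self (stirlingSeq_pos (ha.trans_le hab)).ne']
  | succ k ih =>
    have pos : ∀ {c : ℕ}, a ≤ c → 0 < stirlingSeq c := fun h => stirlingSeq_pos (ha.trans_le h)
    have h1 : stirlingSeq (a + (k + 1)) / stirlingSeq (a + k) ≤
        stirlingSeq (b + (k + 1)) / stirlingSeq (b + k) := by
      have h := log_stirlingSeq_sub_antitone (by omega : a + k - 1 ≤ b + k - 1)
      simp only [show a + k - 1 + 1 = a + k by omega, show a + k - 1 + 2 = a + (k + 1) by omega,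
        show b + k - 1 + 1 = b + k by omega, show b + k - 1 + 2 = b + (k + 1) by omega] at h
      rw [← Real.log_le_log_iff (div_pos (pos (by omega)) (pos (by omega)))
        (div_pos (pos (by omega)) (pos (by omega))),
        Real.log_div (pos (by omega)).ne' (pos (by omega)).ne',
        Real.log_div (pos (by omega)).ne' (pos (by omega)).ne']
      linarith
    have hak := pos (by omega : a ≤ a + k)
    have hbk := pos (by omega : a ≤ b + k)
    calc stirlingSeq (a + (k + 1)) / stirlingSeq a
        = stirlingSeq (a + (k + 1)) / stirlingSeq (a + k) *
          (stirlingSeq (a + k) / stirlingSeq a) := by rw [div_mul_div_cancel₀ hak.ne']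
      _ ≤ stirlingSeq (b + (k + 1)) / stirlingSeq (b + k) *
          (stirlingSeq (b + k) / stirlingSeq b) := mul_le_mul h1 ih
            (div_pos hak (pos le_rfl)).le (div_pos (pos (by omega)) hbk).le
      _ = _ := by rw [div_mul_div_cancel₀ hbk.ne']

/-- The square root completes `m! / (m - k)!` to a Stirling ratio. Outside that ratio `m` enters
only as `m ^ k`, so passing from `n` to `d * n` there costs exactly `d ^ k`. -/
theorem choose_mul_eq_stirlingSeq {m k : ℕ} (hk : k < m) :
    (m.choose k : ℝ) * ((1 - (k : ℝ) / m) ^ (m - k) * √(1 - (k : ℝ) / m)) =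
      stirlingSeq m / stirlingSeq (m - k) * (m ^ k / (k.factorial * Real.exp 1 ^ k)) := by
  obtain ⟨a, rfl⟩ := Nat.exists_eq_add_of_lt hk
  have hsub : k + a + 1 - k = a + 1 := by omega
  rw [hsub, Nat.cast_choose ℝ hk.le, hsub]
  set m : ℕ := k + a + 1 with hm
  have hm0 : (0 : ℝ) < m := by exact_mod_cast (by omega : 0 < m)
  have ha0 : (0 : ℝ) < (a + 1 : ℕ) := by exact_mod_cast Nat.succ_pos a
  have h1 : 1 - (k : ℝ) / m = (a + 1 : ℕ) / m := by
    rw [eq_div_iff hm0.ne', sub_mul, div_mul_cancel₀ _ hm0.ne', one_mul, hm]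
    push_cast
    ring
  have hpow : ∀ y : ℝ, y ^ m = y ^ k * y ^ (a + 1) := fun y => by rw [← pow_add]; rfl
  rw [h1, Real.sqrt_div ha0.le]
  unfold stirlingSeq
  rw [Real.sqrt_mul zero_le_two, Real.sqrt_mul zero_le_two, div_pow, div_pow, div_pow, hpow m,
    hpow (Real.exp 1)]
  have := Real.sqrt_pos.2 hm0
  have := Real.sqrt_pos.2 ha0
  have := Real.exp_pos 1
  have : (0 : ℝ) < (a + 1).factorial := by exact_mod_cast Nat.factorial_pos _
  have : (0 : ℝ) < k.factorial := by exact_mod_cast Nat.factorial_pos _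
  field_simp

theorem choose_mul_pow_le {d n k : ℕ} (hd : 1 ≤ d) (hk : k < n) :
    (n.choose k : ℝ) * d ^ k * ((1 - (k : ℝ) / n) ^ (n - k) * √(1 - (k : ℝ) / n)) ≤
      ((d * n).choose k : ℝ) * ((1 - (k : ℝ) / (d * n : ℕ)) ^ (d * n - k) *
        √(1 - (k : ℝ) / (d * n : ℕ))) := by
  have hle : n ≤ d * n := Nat.le_mul_of_pos_left n hd
  rw [choose_mul_eq_stirlingSeq (hk.trans_le hle), mul_right_comm, choose_mul_eq_stirlingSeq hk]
  have h := stirlingSeq_div_le (k := k) (by omega : 0 < n - k)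
    (by omega : n - k ≤ d * n - k)
  rw [Nat.sub_add_cancel hk.le, Nat.sub_add_cancel (hk.le.trans hle)] at h
  calc _ = stirlingSeq n / stirlingSeq (n - k) *
        (((d * n : ℕ) : ℝ) ^ k / (k.factorial * Real.exp 1 ^ k)) := by
        push_cast
        rw [mul_pow]
        ring
    _ ≤ _ := mul_le_mul_of_nonneg_right h (by positivity)

end Stirling

/-! ### The extremal graph and the conclusion. -/

theorem average_le {d n k : ℕ} (hd : 1 ≤ d) (hk : k < n) {p : ℝ} (hp : p = (k : ℝ) / n) {m : ℕ}
    (hm : m * (d * n).choose k ≤ (n.choose k * d ^ k) ^ 2) :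
    (m : ℝ) ≤ √((1 - p / d) / (1 - p)) *
      (binomialMeanProb n k * Real.exp (2 * (n : ℝ) * entropyG d p)) := by
  have hn0 : (0 : ℝ) < n := by exact_mod_cast (Nat.zero_le k).trans_lt hk
  have hd0 : (0 : ℝ) < d := by exact_mod_cast hd
  have hle : k ≤ d * n := hk.le.trans (Nat.le_mul_of_pos_left n hd)
  have hp1 : 0 < 1 - p := by
    rw [sub_pos, hp, div_lt_one hn0]
    exact_mod_cast hk
  have hq : 0 ≤ 1 - p / d := by
    have : (1 : ℝ) ≤ d := by exact_mod_cast hd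
    rw [sub_nonneg, div_le_one hd0]
    linarith
  have hS := choose_mul_pow_le hd hk
  have e1 : (k : ℝ) / (d * n : ℕ) = p / d := by
    rw [hp]
    push_cast
    field_simp
  have hE := exp_two_mul_entropyG hd (by omega : 1 ≤ n) hk.le
  have e2 : (n : ℝ) * ((d : ℝ) - (k : ℝ) / n) = ((d * n - k : ℕ) : ℝ) := by
    rw [Nat.cast_sub hle]
    push_cast
    field_simp
  rw [e2, Real.rpow_natCast] at hE
  rw [e1] at hS
  rw [← hp] at hS hE
  set Q := (1 - p / d) ^ (d * n - k)
  set P := (1 - p) ^ (n - k) with hP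
  have hP0 : 0 < P := pow_pos hp1 _
  have hm' : (m : ℝ) * (d * n).choose k ≤ ((n.choose k : ℝ) * d ^ k) ^ 2 := by exact_mod_cast hm
  have hC : (0 : ℝ) < (d * n).choose k := by exact_mod_cast Nat.choose_pos hle
  -- Multiplication by `P` puts the target in the form compared by `hS`: one factor `n.choose k * d
  -- ^ k` of the squared average is traded for `(d * n).choose k`, which cancels.
  have hB : binomialMeanProb n k * Real.exp (2 * (n : ℝ) * entropyG d p) * P =
      n.choose k * d ^ k * Q := by
    rw [mul_assoc (n.choose k : ℝ), ← hE, binomialMeanProb, ← hp, mul_comm 2 (n - k), pow_mul,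
      ← hP]
    ring
  have hs : 0 < √(1 - p) := Real.sqrt_pos.2 hp1
  have h1 : (m : ℝ) * (P * √(1 - p)) ≤ n.choose k * d ^ k * Q * √(1 - p / d) := by
    refine le_of_mul_le_mul_right ?_ hC
    calc (m : ℝ) * (P * √(1 - p)) * (d * n).choose k
        = (m : ℝ) * (d * n).choose k * (P * √(1 - p)) := by ring
      _ ≤ ((n.choose k : ℝ) * d ^ k) ^ 2 * (P * √(1 - p)) :=
          mul_le_mul_of_nonneg_right hm' (by positivity)
      _ = (n.choose k : ℝ) * d ^ k * ((n.choose k : ℝ) * d ^ k * (P * √(1 - p))) := by ring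
      _ ≤ (n.choose k : ℝ) * d ^ k * (((d * n).choose k : ℝ) * (Q * √(1 - p / d))) :=
          mul_le_mul_of_nonneg_left hS (by positivity)
      _ = _ := by ring
  rw [Real.sqrt_div hq]
  refine le_of_mul_le_mul_right (h1.trans (le_of_eq ?_)) (mul_pos hP0 hs)
  rw [← hB]
  field_simp

theorem exists_graph_numMatchings_le {d n k : ℕ} (hd : 1 ≤ d) (hk : k < n) {p : ℝ}
    (hp : p = (k : ℝ) / n) :
    ∃ G : Graph (Fin (2 * n)) (Fin (d * n)),
      G.IsBipartite ∧ G.IsRegular d ∧ G.vertexSet.encard = ((2 * n : ℕ) : ℕ∞) ∧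
      (G.numMatchings k : ℝ) ≤ √((1 - p / d) / (1 - p)) *
        (binomialMeanProb n k * Real.exp (2 * (n : ℝ) * entropyG d p)) := by
  let φ : Fin n ⊕ Fin n ≃ Fin (2 * n) :=
    Fintype.equivFinOfCardEq (by simp [two_mul])
  let ψ : Fin (d * n) ≃ Fin d × Fin n := finProdFinEquiv.symm
  let b : Fin (d * n) → Fin n := fun e => (ψ e).2
  have hdeg : ∀ v, (univ.filter fun e => b e = v).card = d := by
    intro v
    rw [card_equiv (t := univ ×ˢ {v}) ψ fun e => by
      simp only [mem_filter, mem_univ, true_and, mem_product, mem_singleton, b]]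
    simp
  -- Each of the `n` classes of `b` holds `d` half-edges. The same `b` serves both sides, and the
  -- edge `e` joins the class of `e` on the left to the class of `π e` on the right.
  obtain ⟨π, hπ⟩ := exists_perm_card_matchings_le b univ (fun _ => mem_univ _) (by simp)
    (fun v _ => hdeg v) k (n := n)
  rw [Fintype.card_fin] at hπ
  let l : Fin (d * n) → Fin (2 * n) := fun e => φ (Sum.inl (b e))
  let r : Fin (d * n) → Fin (2 * n) := fun e => φ (Sum.inr (b (π e)))
  let c : Fin (2 * n) → Bool := fun x => (φ.symm x).isLeft
  have hl : ∀ e, c (l e) = true := fun e => by simp [c, l]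
  have hr : ∀ e, c (r e) = false := fun e => by simp [c, r]
  refine ⟨graphOfEnds l r, graphOfEnds_isBipartite c l r hl hr,
    graphOfEnds_isRegular c l r hl hr d fun x => ?_, ?_, ?_⟩
  · obtain ⟨v | v, rfl⟩ := φ.surjective x
    · simpa [l, r] using hdeg v
    · refine Eq.trans ?_ (hdeg v)
      exact card_equiv π fun e => by simp [l, r]
  · change (Set.univ : Set (Fin (2 * n))).encard = _
    rw [Set.encard_univ]
    simp
  · refine average_le hd hk hp ?_
    rw [numMatchings_eq _ c l r univ (by simp [graphOfEnds_edgeSet])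
      (fun e _ => graphOfEnds_isLink l r e) (fun e _ => hl e) (fun e _ => hr e)]
    have : matchings l r univ = matchings b (b ∘ π) univ := by
      ext M
      simp [mem_matchings, Set.InjOn, l, r]
    rwa [this]

end BipartiteMatching

theorem mainTheorem1 {α : Type*} {β : Type*} (d n : ℕ) (hd : 1 ≤ d) (hn : 1 ≤ n) :
    (∀ G : Graph α β, G.IsBipartite → G.IsRegular d → G.vertexSet.encard = ((2 * n : ℕ) : ℕ∞) →
      ∀ k : ℕ, k ≤ n → ∀ p : ℝ, p = (k : ℝ) / (n : ℝ) →
        binomialMeanProb n k * Real.exp (2 * (n : ℝ) * entropyG d p) ≤ (G.numMatchings k : ℝ) ∧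
        (n.choose k : ℝ) ^ 2 * (((d : ℝ) - p) / d) ^ ((n : ℝ) * ((d : ℝ) - p)) *
            ((d : ℝ) * p) ^ ((n : ℝ) * p) ≤ (G.numMatchings k : ℝ)) ∧
    (∀ k : ℕ, k < n → ∀ p : ℝ, p = (k : ℝ) / (n : ℝ) →
      ∃ G : Graph (Fin (2 * n)) (Fin (d * n)),
        G.IsBipartite ∧ G.IsRegular d ∧ G.vertexSet.encard = ((2 * n : ℕ) : ℕ∞) ∧
        (G.numMatchings k : ℝ) ≤ Real.sqrt ((1 - p / d) / (1 - p)) *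
          (binomialMeanProb n k * Real.exp (2 * (n : ℝ) * entropyG d p))) := by
  classical
  refine ⟨fun G hb hreg hV k hk p hp => ?_, fun k hk p hp =>
    BipartiteMatching.exists_graph_numMatchings_le hd hk hp⟩
  obtain ⟨l, r, F, L, R, hl, hr, hdl, hdr, hL, hR, hcard⟩ :=
    BipartiteMatching.exists_ends hd hn G hb hreg hV
  have h := BipartiteMatching.card_matchings_ge hd hn l r F L R hl hr hdl hdr hL hR hk
  rw [← hcard, ← hp] at h
  exact ⟨h, (BipartiteMatching.friedland_le hd hn hk hp).trans h⟩
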